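/- **Conventions.** All Hilbert spaces are complex. Fix an index set $I$ (of an orthonormal basis of the common multiplicity space $\mathcal P$; neither $I$ countable nor the Hilbert spaces separable is needed). Words $\alpha=\alpha_1\cdots\alpha_n$ are elements of the free semigroup $F^+$ on $I$, including the empty word $0$, and $V_\alpha=V_{\alpha_1}\cdots V_{\alpha_n}$, $V_0=1$. A *row isometry* on $\mathcal H$ is a family $V=(V_i)_{i\in I}$ of isometries of $\mathcal H$ with mutually orthogonal ranges. A (discrete weak Markov) *process* $(\mathcal H,V,\mathfrak h)$ consists of a Hilbert space $\mathcal H$, a row isometry $V$ on $\mathcal H$ and a closed subspace $\mathfrak h$ with $V_i^*\mathfrak h\subset\mathfrak h$ for all $i$ and $\mathcal H=\overline{\mathrm{span}}\{V_\alpha\mathfrak h:\alpha\in F^+\}$. A *morphism* $(\mathcal R,V^{\mathcal R},\mathfrak r)\to(\mathcal S,V^{\mathcal S},\mathfrak s)$ is a contraction $t:\mathfrak r\to\mathfrak s$ with $V_i^{\mathcal S*}t=tV_i^{\mathcal R*}|_{\mathfrak r}$ for all $i$. An *extension* of $\mathcal K$ by $\mathcal G$ is a short exact sequence $0\to(\mathcal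 G,V^{\mathcal G},\mathfrak g)\xrightarrow{a}(\mathcal H,V,\mathfrak h)\xrightarrow{b}(\mathcal K,V^{\mathcal K},\mathfrak k)\to0$, i.e. $a$ is an isometric morphism, $b$ is a coisometric morphism and $a(\mathfrak g)=\ker b$. Two extensions with middle terms $\mathcal H,\mathcal H'$ and maps $(a,b)$, $(a',b')$ are *equivalent* if there is an isomorphism of processes $j:\mathfrak h\to\mathfrak h'$ (a unitary such that $j$ and $j^{-1}$ are morphisms) with $ja=a'$ and $b'j=b$. A process $\mathcal G$ is a *subprocess* of $(\mathcal H,V,\mathfrak h)$ if $\mathfrak g\subset\mathfrak h$ is closed and co-invariant for $V$, $\mathcal G=\overline{\mathrm{span}}\{V_\alpha\mathfrak g\}$ and $V^{\mathcal G}=V|_{\mathcal G}$; the corresponding *quotient process* is $(\mathcal K,V|_{\mathcal K},\mathfrak k)$ with $\mathfrak k=\mathfrak h\ominus\mathfrak g$, $\mathcal K=\overline{\mathrm{span}}\{V_\alpha\mathfrak k\}$. $P_{\mathcal L}$ denotes the orthogonal projection onto $\mathcal L$. Let $(\mathcal G,V^{\mathcal G},\mathfrak g)$ and $(\mathcal K,V^{\mathcal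 K},\mathfrak k)$ be processes, and put, with $V^{\mathcal G}(\mathfrak g\otimes\mathcal P)=\overline{\mathrm{span}}\{V_i^{\mathcal G}\mathfrak g: i\in I\}$ and likewise for $\mathcal K$, $$\mathcal E^{\mathfrak g}=\overline{\mathrm{span}}(\mathfrak g,V^{\mathcal G}(\mathfrak g\otimes\mathcal P))\ominus\mathfrak g,\qquad \mathcal E^{\mathfrak k}_*=\overline{\mathrm{span}}(\mathfrak k,V^{\mathcal K}(\mathfrak k\otimes\mathcal P))\ominus V^{\mathcal K}(\mathfrak k\otimes\mathcal P).$$ For a contraction $\gamma:\mathcal E^{\mathfrak k}_*\to\mathcal E^{\mathfrak g}$ let $D_{\gamma^*}=\sqrt{1-\gamma\gamma^*}$ and $\mathcal D_{\gamma^*}=\overline{\mathrm{ran}}\,D_{\gamma^*}$. The *$\gamma$-cascade* $\mathcal G\lhd_\gamma\mathcal K=(\mathcal H,V,\mathfrak h)$ is given by $\mathfrak h=\mathfrak g\oplus\mathfrak k$, $\mathcal H=\mathfrak g\oplus\mathcal K\oplus\bigoplus_{\alpha\in F^+}(\mathcal D_{\gamma^*})_\alpha$ and $$V_i(g,k,d)=\big(P_{\mathfrak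 g}V_i^{\mathcal G}g,\ \gamma^*P_{\mathcal E^{\mathfrak g}}V_i^{\mathcal G}g+V_i^{\mathcal K}k,\ (D_{\gamma^*}P_{\mathcal E^{\mathfrak g}}V_i^{\mathcal G}g)_0+S_id\big),$$ where $S_i$ maps the copy $(\mathcal D_{\gamma^*})_\alpha$ identically onto $(\mathcal D_{\gamma^*})_{i\alpha}$. **Theorem.** 1. For every contraction $\gamma:\mathcal E^{\mathfrak k}_*\to\mathcal E^{\mathfrak g}$ the $\gamma$-cascade is a process (and $\mathcal H$ is separable if $I$ is countable and $\mathcal G,\mathcal K$ are separable). The inclusion $\mathfrak g\to\mathfrak g\oplus\mathfrak k$ extends to an isometry $\mathcal G\to\mathcal H$ intertwining $V_i^{\mathcal G}$ and $V_i$ for all $i$; identifying $\mathcal G$ with its image and $\mathcal K$ with the second summand of $\mathcal H$, $(\mathcal G,V^{\mathcal G},\mathfrak g)$ is a subprocess of the $\gamma$-cascade, $(\mathcal K,V^{\mathcal K},\mathfrak k)$ is the corresponding quotient process, and $$\gamma=P_{\mathcal E^{\mathfrak g}}|_{\mathcal E^{\mathfrak k}_*}=P_{\mathcal G}|_{\mathcal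 E^{\mathfrak k}_*},\qquad \gamma^*=P_{\mathcal E^{\mathfrak k}_*}|_{\mathcal E^{\mathfrak g}}=P_{\mathcal K}|_{\mathcal E^{\mathfrak g}}.$$ The inclusion $1_{\mathfrak g}:\mathfrak g\to\mathfrak g\oplus\mathfrak k$ and the projection $P_{\mathfrak k}:\mathfrak g\oplus\mathfrak k\to\mathfrak k$ form a short exact sequence $0\to\mathcal G\to\mathcal G\lhd_\gamma\mathcal K\to\mathcal K\to0$. 2. Conversely, for every extension $0\to\mathcal G\to\mathcal H'\to\mathcal K\to0$ of $\mathcal K$ by $\mathcal G$ there is exactly one contraction $\gamma:\mathcal E^{\mathfrak k}_*\to\mathcal E^{\mathfrak g}$ such that it is equivalent to the extension given by the $\gamma$-cascade. 3. For contractions $\gamma_1,\gamma_2:\mathcal E^{\mathfrak k}_*\to\mathcal E^{\mathfrak g}$, the extensions given by the $\gamma_1$-cascade and the $\gamma_2$-cascade are equivalent if and only if $\gamma_1=\gamma_2$. Hence equivalence classes of extensions of $\mathcal K$ by $\mathcal G$ correspond one-to-one to contractions $\mathcal E^{\mathfrak k}_*\to\mathcal E^{\mathfrak g}$. -/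

import Mathlib

open scoped InnerProductSpace ENNReal

noncomputable section

/-! ## Row isometries, co-invariant subspaces, discrete weak Markov processes

The multiplicity space enters through an orthonormal basis indexed by `ι`, so that a row operator
`V : H ⊗ P → H` is the family of its components `V i : H → H`, `i : ι`.  Words in the free
semigroup on `ι` are lists over `ι`, the empty list being the empty word. -/

/-- `V_α = V_{α₁} ⋯ V_{αₙ}` for a word `α = α₁ … αₙ` (the identity for the empty word). -/
def wordOp {ι H : Type*} [NormedAddCommGroup H] [InnerProductSpace ℂ H]
    (V : ι → H →L[ℂ] H) (α : List ι) : H →L[ℂ] H :=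
  (α.map V).prod

/-- `V` is a row isometry: the `V i` are isometries with mutually orthogonal ranges. -/
def IsRowIsometry {ι H : Type*} [NormedAddCommGroup H] [InnerProductSpace ℂ H]
    (V : ι → H →L[ℂ] H) : Prop :=
  (∀ i, Isometry (V i)) ∧ ∀ i j, i ≠ j → ∀ x y, ⟪V i x, V j y⟫_ℂ = 0

/-- `s` is co-invariant: `V_i^* s ⊆ s` for all `i`. -/
def IsCoinvariant {ι H : Type*} [NormedAddCommGroup H] [InnerProductSpace ℂ H] [CompleteSpace H]
    (V : ι → H →L[ℂ] H) (s : Submodule ℂ H) : Prop :=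
  ∀ i, ∀ x ∈ s, ContinuousLinearMap.adjoint (V i) x ∈ s

/-- The closed linear span of all `V_α s`, `α` a word. -/
def orbitSpan {ι H : Type*} [NormedAddCommGroup H] [InnerProductSpace ℂ H]
    (V : ι → H →L[ℂ] H) (s : Submodule ℂ H) : Submodule ℂ H :=
  (⨆ α : List ι, s.map (wordOp V α).toLinearMap).topologicalClosure

/-- A Hilbert space with a family of operators and a closed subspace, without any further
condition.  It is a process if `ProcessData.IsWeakMarkov` holds. -/
structure ProcessData (ι H : Type*) [NormedAddCommGroup H] [InnerProductSpace ℂ H] where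
  V : ι → H →L[ℂ] H
  base : Submodule ℂ H
  isClosed_base : IsClosed (base : Set H)

namespace ProcessData

variable {ι H : Type*} [NormedAddCommGroup H] [InnerProductSpace ℂ H] [CompleteSpace H]

/-- `(H, V, base)` is a discrete weak Markov process. -/
structure IsWeakMarkov (P : ProcessData ι H) : Prop where
  rowIsometry : IsRowIsometry P.V
  coinvariant : IsCoinvariant P.V P.base
  minimal : orbitSpan P.V P.base = ⊤

instance completeSpace_base (P : ProcessData ι H) : CompleteSpace P.base :=
  P.isClosed_base.completeSpace_coe

/-- The linear span of all `V_i base`; its closure is `V (base ⊗ P)` for a row isometry `V`. -/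
def imageSpan (P : ProcessData ι H) : Submodule ℂ H :=
  ⨆ i, P.base.map (P.V i).toLinearMap

/-- `E = closure (span (base, V (base ⊗ P))) ⊖ base`. -/
def wandering (P : ProcessData ι H) : Submodule ℂ H :=
  (P.base ⊔ P.imageSpan).topologicalClosure ⊓ P.baseᗮ

/-- `E_* = closure (span (base, V (base ⊗ P))) ⊖ V (base ⊗ P)`. -/
def wanderingStar (P : ProcessData ι H) : Submodule ℂ H :=
  (P.base ⊔ P.imageSpan).topologicalClosure ⊓ P.imageSpanᗮ

instance completeSpace_wandering (P : ProcessData ι H) : CompleteSpace P.wandering :=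
  ((Submodule.isClosed_topologicalClosure (P.base ⊔ P.imageSpan)).inter
    (Submodule.isClosed_orthogonal P.base)).isComplete.completeSpace_coe

instance completeSpace_wanderingStar (P : ProcessData ι H) : CompleteSpace P.wanderingStar :=
  ((Submodule.isClosed_topologicalClosure (P.base ⊔ P.imageSpan)).inter
    (Submodule.isClosed_orthogonal P.imageSpan)).isComplete.completeSpace_coe

end ProcessData

/-! ## Morphisms, short exact sequences, subprocesses and quotient processes -/

section Morphisms

variable {ι 𝒢 ℋ 𝒦 ℛ 𝒮 : Type*}
  [NormedAddCommGroup 𝒢] [InnerProductSpace ℂ 𝒢] [CompleteSpace 𝒢]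
  [NormedAddCommGroup ℋ] [InnerProductSpace ℂ ℋ] [CompleteSpace ℋ]
  [NormedAddCommGroup 𝒦] [InnerProductSpace ℂ 𝒦] [CompleteSpace 𝒦]
  [NormedAddCommGroup ℛ] [InnerProductSpace ℂ ℛ] [CompleteSpace ℛ]
  [NormedAddCommGroup 𝒮] [InnerProductSpace ℂ 𝒮] [CompleteSpace 𝒮]

/-- A morphism `R → S` is a contraction `t : R.base → S.base` that intertwines the adjoints of the
row operators: `V_i^{S*} (t x) = t (V_i^{R*} x)` for `x ∈ R.base`, where `V_i^{R*} x ∈ R.base`. -/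
structure IsMorphism (R : ProcessData ι ℛ) (S : ProcessData ι 𝒮) (t : R.base →L[ℂ] S.base) :
    Prop where
  contraction : ‖t‖ ≤ 1
  intertwine : ∀ (i : ι) (x : R.base), ∃ y : R.base,
    (y : ℛ) = ContinuousLinearMap.adjoint (R.V i) (x : ℛ) ∧
      ContinuousLinearMap.adjoint (S.V i) (t x : 𝒮) = (t y : 𝒮)

/-- `0 → G → H → K → 0` is a short exact sequence: `a` is an isometric morphism, `b` is a
coisometric morphism, and the image of `a` is the kernel of `b`. -/
structure IsShortExact (G : ProcessData ι 𝒢) (H : ProcessData ι ℋ) (K : ProcessData ι 𝒦)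
    (a : G.base →L[ℂ] H.base) (b : H.base →L[ℂ] K.base) : Prop where
  morphism_left : IsMorphism G H a
  isometric : Isometry a
  morphism_right : IsMorphism H K b
  coisometric : b ∘L ContinuousLinearMap.adjoint b = ContinuousLinearMap.id ℂ K.base
  exact : LinearMap.range a.toLinearMap = LinearMap.ker b.toLinearMap

/-- Equivalence of the extensions `G → R → K` and `G → S → K`: an isomorphism of processes
`R → S` that makes the diagram with identities on `G` and `K` commute. -/
def ExtensionsEquivalent {G : ProcessData ι 𝒢} {K : ProcessData ι 𝒦}
    {R : ProcessData ι ℛ} {S : ProcessData ι 𝒮}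
    (a : G.base →L[ℂ] R.base) (b : R.base →L[ℂ] K.base)
    (a' : G.base →L[ℂ] S.base) (b' : S.base →L[ℂ] K.base) : Prop :=
  ∃ j : R.base ≃ₗᵢ[ℂ] S.base,
    IsMorphism R S (j : R.base →L[ℂ] S.base) ∧ IsMorphism S R (j.symm : S.base →L[ℂ] R.base) ∧
      (∀ x, j (a x) = a' x) ∧ ∀ x, b' (j x) = b x

/-- `j` identifies `G` with a subprocess of `H`: the subspace `j(G.base)` of `H.base` is
co-invariant for `V^H`, and `j` carries the space of `G` onto the closed span of all
`V_α^H j(G.base)` and `V^G` to the restriction of `V^H`. -/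
structure IsSubprocessOf (G : ProcessData ι 𝒢) (H : ProcessData ι ℋ) (j : 𝒢 →ₗᵢ[ℂ] ℋ) : Prop where
  base_le : G.base.map j.toLinearMap ≤ H.base
  coinvariant : IsCoinvariant H.V (G.base.map j.toLinearMap)
  range_eq : LinearMap.range j.toLinearMap = orbitSpan H.V (G.base.map j.toLinearMap)
  intertwine : ∀ i x, j (G.V i x) = H.V i (j x)

/-- `j` identifies `K` with the quotient process of `H` by a subprocess with base `g ⊆ H`: `j`
carries `K.base` onto `H.base ⊖ g`, the space of `K` onto the closed span of all
`V_α^H (H.base ⊖ g)`, and `V^K` to the restriction of `V^H`. -/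
structure IsQuotientOf (H : ProcessData ι ℋ) (g : Submodule ℂ ℋ) (K : ProcessData ι 𝒦)
    (j : 𝒦 →ₗᵢ[ℂ] ℋ) : Prop where
  base_eq : K.base.map j.toLinearMap = H.base ⊓ gᗮ
  range_eq : LinearMap.range j.toLinearMap = orbitSpan H.V (H.base ⊓ gᗮ)
  intertwine : ∀ i x, j (K.V i x) = H.V i (j x)

end Morphisms

/-- The orthogonal projection onto the image `j(s)` of a closed subspace `s` under an isometry. -/
def imageProj {E F : Type*} [NormedAddCommGroup E] [InnerProductSpace ℂ E]
    [NormedAddCommGroup F] [InnerProductSpace ℂ F] (j : E →ₗᵢ[ℂ] F) (s : Submodule ℂ E)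
    [CompleteSpace s] : F →L[ℂ] F :=
  haveI : CompleteSpace (s.map j.toLinearMap) := LinearIsometry.completeSpace_map j s
  (s.map j.toLinearMap).starProjection

instance completeSpace_top_submodule {E : Type*} [NormedAddCommGroup E] [InnerProductSpace ℂ E]
    [CompleteSpace E] : CompleteSpace (⊤ : Submodule ℂ E) :=
  (isClosed_univ : IsClosed ((⊤ : Submodule ℂ E) : Set E)).completeSpace_coe

/-! ## Defect operators and the canonical row shift -/

/-- The defect operator `D_T = √(1 - T^* T)`. -/
def defectOp {A B : Type*} [NormedAddCommGroup A] [InnerProductSpace ℂ A] [CompleteSpace A]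
    [NormedAddCommGroup B] [InnerProductSpace ℂ B] [CompleteSpace B] (T : A →L[ℂ] B) :
    A →L[ℂ] A :=
  CFC.sqrt (1 - ContinuousLinearMap.adjoint T ∘L T)

/-- The defect space, the closure of the range of the defect operator. -/
def defectSpace {A B : Type*} [NormedAddCommGroup A] [InnerProductSpace ℂ A] [CompleteSpace A]
    [NormedAddCommGroup B] [InnerProductSpace ℂ B] [CompleteSpace B] (T : A →L[ℂ] B) :
    Submodule ℂ A :=
  (LinearMap.range (defectOp T).toLinearMap).topologicalClosure

instance completeSpace_defectSpace {A B : Type*}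
    [NormedAddCommGroup A] [InnerProductSpace ℂ A] [CompleteSpace A]
    [NormedAddCommGroup B] [InnerProductSpace ℂ B] [CompleteSpace B] (T : A →L[ℂ] B) :
    CompleteSpace (defectSpace T) :=
  (Submodule.isClosed_topologicalClosure _).completeSpace_coe

/-- The defect operator as a map `A → D_T`. -/
def toDefectSpace {A B : Type*} [NormedAddCommGroup A] [InnerProductSpace ℂ A] [CompleteSpace A]
    [NormedAddCommGroup B] [InnerProductSpace ℂ B] [CompleteSpace B] (T : A →L[ℂ] B) :
    A →L[ℂ] defectSpace T :=
  (defectOp T).codRestrict (defectSpace T) fun x =>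
    Submodule.le_topologicalClosure _ (LinearMap.mem_range_self _ x)

/-- The Hilbert space direct sum of copies of `D` indexed by the words over `ι`. -/
abbrev WordSum (ι D : Type*) [NormedAddCommGroup D] : Type _ :=
  lp (fun _ : List ι => D) 2

section Shift

variable {ι D : Type*} [NormedAddCommGroup D]

theorem hasSum_norm_extend_cons (i : ι) (x : WordSum ι D) :
    HasSum (fun α => ‖Function.extend (List.cons i) (x : List ι → D) 0 α‖ ^ (2 : ℝ≥0∞).toReal)
      (‖x‖ ^ (2 : ℝ≥0∞).toReal) := by
  have h := lp.hasSum_norm (p := 2) (by norm_num) x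
  have hinj : Function.Injective (List.cons i) := List.cons_injective
  rw [← hinj.hasSum_iff]
  · convert h using 2 with α
    simp
  · intro α hα
    rw [Function.extend_apply' _ _ _ (by simpa using hα)]
    simp

variable [InnerProductSpace ℂ D]

/-- The `i`-th component of the canonical row shift: it moves the copy with index `α` identically
onto the copy with index `iα`. -/
def rowShift (i : ι) : WordSum ι D →ₗᵢ[ℂ] WordSum ι D where
  toFun x := ⟨Function.extend (List.cons i) (x : List ι → D) 0,
    memℓp_gen (hasSum_norm_extend_cons i x).summable⟩
  map_add' x y := by
    ext α
    change Function.extend (List.cons i) ((x : List ι → D) + (y : List ι → D)) 0 α =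
      Function.extend (List.cons i) (x : List ι → D) 0 α
        + Function.extend (List.cons i) (y : List ι → D) 0 α
    have hinj : Function.Injective (List.cons i) := List.cons_injective
    by_cases h : ∃ β, i :: β = α
    · obtain ⟨β, rfl⟩ := h
      simp only [hinj.extend_apply, Pi.add_apply]
    · simp only [Function.extend_apply' _ _ _ h, Pi.zero_apply, add_zero]
  map_smul' c x := by
    ext α
    change Function.extend (List.cons i) (c • (x : List ι → D)) 0 α =
      c • Function.extend (List.cons i) (x : List ι → D) 0 α
    have hinj : Function.Injective (List.cons i) := List.cons_injective
    by_cases h : ∃ β, i :: β = α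
    · obtain ⟨β, rfl⟩ := h
      simp only [hinj.extend_apply, Pi.smul_apply]
    · simp only [Function.extend_apply' _ _ _ h, Pi.zero_apply, smul_zero]
  norm_map' x := by
    have h1 := lp.norm_rpow_eq_tsum (p := 2) (by norm_num)
      (⟨Function.extend (List.cons i) (x : List ι → D) 0,
        memℓp_gen (hasSum_norm_extend_cons i x).summable⟩ : WordSum ι D)
    have h2 := (hasSum_norm_extend_cons i x).tsum_eq
    have h3 := h1.trans h2
    have h4 : (0 : ℝ) < (2 : ℝ≥0∞).toReal := by norm_num
    exact (Real.rpow_left_inj (norm_nonneg _) (norm_nonneg _) h4.ne').1 h3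

end Shift

/-! ## The cascade -/

section Cascade

variable {ι 𝒢 𝒦 : Type*}
  [NormedAddCommGroup 𝒢] [InnerProductSpace ℂ 𝒢] [CompleteSpace 𝒢]
  [NormedAddCommGroup 𝒦] [InnerProductSpace ℂ 𝒦] [CompleteSpace 𝒦]
  (G : ProcessData ι 𝒢) (K : ProcessData ι 𝒦) (γ : K.wanderingStar →L[ℂ] G.wandering)

/-- The direct sum of copies, indexed by the words, of the defect space of `γ^*`. -/
abbrev CascadeDefect : Type _ :=
  WordSum ι (defectSpace (ContinuousLinearMap.adjoint γ))

/-- The Hilbert space `𝔤 ⊕ 𝒦 ⊕ ⨁_α (D_{γ^*})_α`. -/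
def CascadeSpace : Type _ :=
  WithLp 2 (G.base × WithLp 2 (𝒦 × CascadeDefect G K γ))

instance : NormedAddCommGroup (CascadeSpace G K γ) :=
  inferInstanceAs (NormedAddCommGroup (WithLp 2 (G.base × WithLp 2 (𝒦 × CascadeDefect G K γ))))

instance : InnerProductSpace ℂ (CascadeSpace G K γ) :=
  inferInstanceAs (InnerProductSpace ℂ (WithLp 2 (G.base × WithLp 2 (𝒦 × CascadeDefect G K γ))))

instance : CompleteSpace (CascadeSpace G K γ) :=
  inferInstanceAs (CompleteSpace (WithLp 2 (G.base × WithLp 2 (𝒦 × CascadeDefect G K γ))))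

namespace Cascade

/-- The identification of `𝔤 × 𝒦 × ⨁_α (D_{γ^*})_α` with the cascade space, as vector spaces
with topology: `(g, k, d)` is sent to the element with these components. -/
def mkEquiv : (G.base × 𝒦 × CascadeDefect G K γ) ≃L[ℂ]
    WithLp 2 (G.base × WithLp 2 (𝒦 × CascadeDefect G K γ)) :=
  ((ContinuousLinearEquiv.refl ℂ G.base).prodCongr
    (WithLp.prodContinuousLinearEquiv 2 ℂ 𝒦 (CascadeDefect G K γ)).symm).trans
      (WithLp.prodContinuousLinearEquiv 2 ℂ G.base (WithLp 2 (𝒦 × CascadeDefect G K γ))).symm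

/-- The element `(g, k, d)` of the cascade space. -/
def mk : (G.base × 𝒦 × CascadeDefect G K γ) →L[ℂ] CascadeSpace G K γ :=
  (mkEquiv G K γ).toContinuousLinearMap

/-- The component in `𝔤`. -/
def fstL : CascadeSpace G K γ →L[ℂ] G.base :=
  WithLp.fstL 2 ℂ _ _

/-- The component in `𝒦`. -/
def sndL : CascadeSpace G K γ →L[ℂ] 𝒦 :=
  WithLp.fstL 2 ℂ _ _ ∘L WithLp.sndL 2 ℂ _ _

/-- The component in the direct sum of copies of the defect space. -/
def thdL : CascadeSpace G K γ →L[ℂ] CascadeDefect G K γ :=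
  WithLp.sndL 2 ℂ _ _ ∘L WithLp.sndL 2 ℂ _ _

/-- The part of `V_i^G` that maps `𝔤` into the wandering subspace: `P_{E^𝔤} V_i^G` on `𝔤`. -/
def wanderingPart (i : ι) : G.base →L[ℂ] G.wandering :=
  G.wandering.orthogonalProjectionOnto ∘L G.V i ∘L G.base.subtypeL

open Classical in
/-- The embedding of the defect space as the copy belonging to the empty word. -/
def defectZero : defectSpace (ContinuousLinearMap.adjoint γ) →L[ℂ] CascadeDefect G K γ :=
  lp.singleContinuousLinearMap ℂ
    (fun _ : List ι => defectSpace (ContinuousLinearMap.adjoint γ)) 2 ([] : List ι)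

/-- `V_i (g, k, d) = (P_𝔤 V_i^G g, γ^* P_{E^𝔤} V_i^G g + V_i^K k, (D_{γ^*} P_{E^𝔤} V_i^G g)_0 + S_i d)`
where `S` is the canonical row shift; note that `V_i^G` maps `𝔤` into `𝔤 ⊕ E^𝔤`. -/
def V (i : ι) : CascadeSpace G K γ →L[ℂ] CascadeSpace G K γ :=
  mk G K γ ∘L
    ContinuousLinearMap.prod
      (G.base.orthogonalProjectionOnto ∘L G.V i ∘L G.base.subtypeL ∘L fstL G K γ)
      (ContinuousLinearMap.prod
        (K.wanderingStar.subtypeL ∘L ContinuousLinearMap.adjoint γ ∘L wanderingPart G i ∘L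
            fstL G K γ
          + K.V i ∘L sndL G K γ)
        (defectZero G K γ ∘L toDefectSpace (ContinuousLinearMap.adjoint γ) ∘L
            wanderingPart G i ∘L fstL G K γ
          + (rowShift i).toContinuousLinearMap ∘L thdL G K γ))

/-- The subspace `𝔥 = 𝔤 ⊕ 𝔨`. -/
def base : Submodule ℂ (CascadeSpace G K γ) :=
  K.base.comap (sndL G K γ).toLinearMap ⊓ LinearMap.ker (thdL G K γ).toLinearMap

theorem isClosed_base : IsClosed (base G K γ : Set (CascadeSpace G K γ)) :=
  (K.isClosed_base.preimage (sndL G K γ).continuous).inter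
    (isClosed_singleton.preimage (thdL G K γ).continuous)

end Cascade

/-- The `γ`-cascade of `G` and `K`. -/
def cascade : ProcessData ι (CascadeSpace G K γ) where
  V := Cascade.V G K γ
  base := Cascade.base G K γ
  isClosed_base := Cascade.isClosed_base G K γ

namespace Cascade

/-- The embedding `𝔤 → 𝔥 = 𝔤 ⊕ 𝔨`. -/
def baseIncl : G.base →L[ℂ] (cascade G K γ).base :=
  (mk G K γ ∘L ContinuousLinearMap.inl ℂ _ _).codRestrict (cascade G K γ).base fun g =>
    ⟨(K.base.zero_mem : sndL G K γ (mk G K γ (g, 0, 0)) ∈ K.base),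
      (rfl : thdL G K γ (mk G K γ (g, 0, 0)) = 0)⟩

/-- The orthogonal projection `𝔥 = 𝔤 ⊕ 𝔨 → 𝔨`. -/
def baseProj : (cascade G K γ).base →L[ℂ] K.base :=
  (sndL G K γ ∘L (cascade G K γ).base.subtypeL).codRestrict K.base fun x => x.2.1

/-- The canonical embedding of `𝒦` as the second summand of the cascade space. -/
def inclK : 𝒦 →ₗᵢ[ℂ] CascadeSpace G K γ where
  toLinearMap := (mk G K γ ∘L ContinuousLinearMap.inr ℂ _ _ ∘L
    ContinuousLinearMap.inl ℂ _ _).toLinearMap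
  norm_map' x := by
    refine (WithLp.norm_toLp_snd 2 G.base (WithLp 2 (𝒦 × CascadeDefect G K γ)) _).trans ?_
    exact WithLp.norm_toLp_fst 2 𝒦 (CascadeDefect G K γ) x

end Cascade

end Cascade

end

/-!
Both the cascade and an arbitrary extension are studied through the decomposition
`𝔥 = a(𝔤) ⊕ b^*(𝔨)` of the base of the middle term of a short exact sequence.

A process is determined by the compressions of the `V_i` to its base, since co-invariance reduces
every inner product `⟪V_α x, V_β y⟫` to such compressions.  Consequently a map on the base that
reproduces the correlations `⟪x, V_α y⟫` extends to an intertwining isometry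
(`ProcessData.IsWeakMarkov.exists_intertwining`).  This embeds `𝒢` into the middle term along `a`,
and `𝒦` along `b^*`.

In a short exact sequence the compression of `V_i` to `a(𝔤) ⊕ b^*(𝔨)` is triangular, and its
diagonal is given by `V_i^G` and `V_i^K`.  Hence two extensions are equivalent if and only if the
entries `⟪b^* k, V_i a g⟫` agree (`IsShortExact.extensionsEquivalent_iff`).  For the `γ`-cascade
this entry is `⟪k, γ^* P_{E^𝔤} V_i^G g⟫`.  As the vectors `P_{E^𝔤} V_i^G g` are total in `E^𝔤` and
no nonzero vector of `E_*^𝔨` is orthogonal to `𝔨`, it determines `γ`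
(`Cascade.eq_of_inner_adjoint_eq`); this gives uniqueness.  For an arbitrary extension, with `𝒢` and
`𝒦` embedded, let `γ^*` be the projection onto `E_*^𝔨` restricted to `E^𝔤`.  The
embedded `E^𝔤` is orthogonal to all `V_i b^*(𝔨)`, so that only the `E_*^𝔨`-component of `k` matters
in `⟪b^* k, V_i a g⟫`, which therefore has the required form (`IsShortExact.exists_coupling`).

That the cascade is a process rests on `γ γ^* + D_{γ^*}^2 = 1`, on the orthogonality of `E_*^𝔨` to
the ranges of all `V_i^K`, and, for minimality, on the totality of the `P_{E^𝔤} V_i^G g`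
(`Cascade.isRowIsometry`, `Cascade.eq_top`).  The relation between `γ` and the projections follows
from the explicit form `ξ ↦ (0, γ^* ξ, (D_{γ^*} ξ)_0)` of the embedding of `𝒢` on `E^𝔤`
(`Cascade.map_wandering`) and from the corresponding computation of `⟪x, η⟫` for `x` in `𝒢` and `η`
in `E_*^𝔨` (`Cascade.inner_map_inclK`).
-/

/-! ### Row isometries and closed invariant spans -/

section RowIsometry

variable {ι H : Type*} [NormedAddCommGroup H] [InnerProductSpace ℂ H] {V : ι → H →L[ℂ] H}

@[simp]
theorem wordOp_nil (V : ι → H →L[ℂ] H) (x : H) : wordOp V [] x = x := rfl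

@[simp]
theorem wordOp_cons (V : ι → H →L[ℂ] H) (i : ι) (α : List ι) (x : H) :
    wordOp V (i :: α) x = V i (wordOp V α x) := by
  simp [wordOp]

theorem IsRowIsometry.inner_map_map (hV : IsRowIsometry V) (i : ι) (x y : H) :
    ⟪V i x, V i y⟫_ℂ = ⟪x, y⟫_ℂ :=
  LinearIsometry.inner_map_map
    ⟨(V i).toLinearMap, (AddMonoidHomClass.isometry_iff_norm (V i)).1 (hV.1 i)⟩ x y

/-- The inner product relations characterizing row isometries. -/
theorem isRowIsometry_of_inner (h : ∀ i x y, ⟪V i x, V i y⟫_ℂ = ⟪x, y⟫_ℂ)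
    (h' : ∀ i j, i ≠ j → ∀ x y, ⟪V i x, V j y⟫_ℂ = 0) : IsRowIsometry V := by
  refine ⟨fun i => (AddMonoidHomClass.isometry_iff_norm (V i)).2 fun x => ?_, h'⟩
  rw [@norm_eq_sqrt_re_inner ℂ, @norm_eq_sqrt_re_inner ℂ, h]

theorem le_orbitSpan (V : ι → H →L[ℂ] H) (s : Submodule ℂ H) : s ≤ orbitSpan V s := by
  refine le_trans ?_ (Submodule.le_topologicalClosure _)
  exact fun x hx => Submodule.mem_iSup_of_mem [] ⟨x, hx, rfl⟩

theorem wordOp_mem_orbitSpan (V : ι → H →L[ℂ] H) {s : Submodule ℂ H} (α : List ι) {x : H}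
    (hx : x ∈ s) : wordOp V α x ∈ orbitSpan V s :=
  Submodule.le_topologicalClosure _ (Submodule.mem_iSup_of_mem α ⟨x, hx, rfl⟩)

theorem orbitSpan_le {s N : Submodule ℂ H} (hN : IsClosed (N : Set H)) (hs : s ≤ N)
    (hV : ∀ i, ∀ x ∈ N, V i x ∈ N) : orbitSpan V s ≤ N := by
  refine Submodule.topologicalClosure_minimal _ (iSup_le fun α => ?_) hN
  rintro _ ⟨x, hx, rfl⟩
  change wordOp V α x ∈ N
  induction α with
  | nil => exact hs hx
  | cons i α ih => rw [wordOp_cons]; exact hV i _ ih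

theorem map_mem_orbitSpan {s : Submodule ℂ H} (i : ι) {x : H} (hx : x ∈ orbitSpan V s) :
    V i x ∈ orbitSpan V s := by
  have hle : orbitSpan V s ≤ (orbitSpan V s).comap (V i).toLinearMap := by
    refine Submodule.topologicalClosure_minimal _ (iSup_le fun α => ?_)
      ((Submodule.isClosed_topologicalClosure _).preimage (V i).continuous)
    rintro _ ⟨x, hx, rfl⟩
    change V i (wordOp V α x) ∈ orbitSpan V s
    rw [← wordOp_cons]
    exact wordOp_mem_orbitSpan V _ hx
  exact hle hx

end RowIsometry

/-! ### The wandering subspaces of a process -/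

namespace ProcessData

variable {ι H : Type*} [NormedAddCommGroup H] [InnerProductSpace ℂ H] (P : ProcessData ι H)

theorem mem_closure_of_base {x : H} (hx : x ∈ P.base) :
    x ∈ (P.base ⊔ P.imageSpan).topologicalClosure :=
  Submodule.le_topologicalClosure _ (Submodule.mem_sup_left hx)

theorem map_mem_imageSpan (i : ι) {x : H} (hx : x ∈ P.base) : P.V i x ∈ P.imageSpan :=
  Submodule.mem_iSup_of_mem i ⟨x, hx, rfl⟩

theorem map_mem_closure (i : ι) {x : H} (hx : x ∈ P.base) :
    P.V i x ∈ (P.base ⊔ P.imageSpan).topologicalClosure :=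
  Submodule.le_topologicalClosure _ (Submodule.mem_sup_right (P.map_mem_imageSpan i hx))

variable {P}

theorem closure_le {N : Submodule ℂ H} (hN : IsClosed (N : Set H)) (h0 : P.base ≤ N)
    (h1 : ∀ i, ∀ x ∈ P.base, P.V i x ∈ N) : (P.base ⊔ P.imageSpan).topologicalClosure ≤ N := by
  refine Submodule.topologicalClosure_minimal _ (sup_le h0 (iSup_le fun i => ?_)) hN
  rintro _ ⟨x, hx, rfl⟩
  exact h1 i x hx

theorem inner_eq_zero_of_mem_closure {v y : H} (h0 : ∀ x ∈ P.base, ⟪v, x⟫_ℂ = 0)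
    (h1 : ∀ i, ∀ x ∈ P.base, ⟪v, P.V i x⟫_ℂ = 0)
    (hy : y ∈ (P.base ⊔ P.imageSpan).topologicalClosure) : ⟪v, y⟫_ℂ = 0 := by
  have := closure_le (P := P) (N := (ℂ ∙ v)ᗮ) (Submodule.isClosed_orthogonal _)
    (fun x hx => Submodule.mem_orthogonal_singleton_iff_inner_right.2 (h0 x hx))
    (fun i x hx => Submodule.mem_orthogonal_singleton_iff_inner_right.2 (h1 i x hx)) hy
  exact Submodule.mem_orthogonal_singleton_iff_inner_right.1 this

variable [CompleteSpace H]

/-- `closure (span (base, V (base ⊗ P))) = base ⊕ E`, written with projections. -/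
theorem starProjection_base_add_starProjection_wandering {z : H}
    (hz : z ∈ (P.base ⊔ P.imageSpan).topologicalClosure) :
    P.base.starProjection z + P.wandering.starProjection z = z := by
  have h : P.wandering.starProjection z = z - P.base.starProjection z := by
    refine Submodule.eq_starProjection_of_mem_orthogonal ⟨?_, ?_⟩ ?_
    · exact Submodule.sub_mem _ hz (P.mem_closure_of_base (Submodule.starProjection_apply_mem _ _))
    · exact Submodule.sub_starProjection_mem_orthogonal _
    · intro w hw
      rw [sub_sub_cancel]
      exact Submodule.inner_left_of_mem_orthogonal (Submodule.starProjection_apply_mem _ _) hw.2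
  rw [h, add_sub_cancel]

/-- The vectors `P_E V_i g`, `g` in the base, are total in `E`. -/
theorem wandering_eq_top {N : Submodule ℂ P.wandering} (hN : IsClosed (N : Set P.wandering))
    (h : ∀ i, ∀ x ∈ P.base, P.wandering.orthogonalProjectionOnto (P.V i x) ∈ N) : N = ⊤ := by
  have hle := closure_le (P := P)
    (N := N.comap P.wandering.orthogonalProjectionOnto.toLinearMap)
    (hN.preimage P.wandering.orthogonalProjectionOnto.continuous)
    (fun x hx => by
      have h0 : P.wandering.orthogonalProjectionOnto x = 0 :=
        Submodule.orthogonalProjectionOnto_eq_zero_iff.2 fun w hw =>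
          Submodule.inner_left_of_mem_orthogonal hx hw.2
      change P.wandering.orthogonalProjectionOnto x ∈ N
      rw [h0]
      exact N.zero_mem)
    h
  refine (Submodule.eq_top_iff').2 fun ξ => ?_
  have := hle ξ.2.1
  change P.wandering.orthogonalProjectionOnto ξ ∈ N at this
  rwa [Submodule.orthogonalProjectionOnto_mem_subspace_eq_self] at this

/-- A functional that vanishes on `V (base ⊗ P)` only sees the component in `E_*` of a vector of
`closure (span (base, V (base ⊗ P)))`. -/
theorem inner_eq_inner_starProjection_wanderingStar {v u : H} (hv : v ∈ P.imageSpanᗮ)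
    (hu : u ∈ (P.base ⊔ P.imageSpan).topologicalClosure) :
    ⟪v, u⟫_ℂ = ⟪v, P.wanderingStar.starProjection u⟫_ℂ := by
  set W := (P.base ⊔ P.imageSpan).topologicalClosure
  have : CompleteSpace W := (Submodule.isClosed_topologicalClosure _).completeSpace_coe
  have hp : P.wanderingStar.starProjection u ∈ P.wanderingStar :=
    Submodule.starProjection_apply_mem _ _
  have hq : W.starProjection v ∈ P.wanderingStar := by
    refine ⟨Submodule.starProjection_apply_mem _ _, fun y hy => ?_⟩
    have hyW : y ∈ W := Submodule.le_topologicalClosure _ (Submodule.mem_sup_right hy)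
    rw [← Submodule.inner_starProjection_left_eq_right,
      Submodule.starProjection_eq_self_iff.2 hyW]
    exact hv y hy
  have h0 : ⟪W.starProjection v, u - P.wanderingStar.starProjection u⟫_ℂ = 0 :=
    Submodule.sub_starProjection_mem_orthogonal u _ hq
  rw [Submodule.inner_starProjection_left_eq_right,
    Submodule.starProjection_eq_self_iff.2 (W.sub_mem hu hp.1), inner_sub_right] at h0
  exact sub_eq_zero.1 h0

namespace IsWeakMarkov

theorem eq_top (hP : P.IsWeakMarkov) {N : Submodule ℂ H} (hN : IsClosed (N : Set H))
    (h0 : P.base ≤ N) (hV : ∀ i, ∀ x ∈ N, P.V i x ∈ N) : N = ⊤ :=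
  top_le_iff.1 (hP.minimal ▸ orbitSpan_le hN h0 hV)

/-- Co-invariance of the base: `V_i` maps `baseᗮ` into the orthogonal complement of
`span (base, V (base ⊗ P))`. -/
theorem inner_map_eq_zero_of_mem_orthogonal (hP : P.IsWeakMarkov) (i : ι) {x y : H}
    (hx : x ∈ P.baseᗮ) (hy : y ∈ (P.base ⊔ P.imageSpan).topologicalClosure) :
    ⟪P.V i x, y⟫_ℂ = 0 := by
  refine inner_eq_zero_of_mem_closure (fun z hz => ?_) (fun j z hz => ?_) hy
  · rw [← ContinuousLinearMap.adjoint_inner_right]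
    exact Submodule.inner_left_of_mem_orthogonal (hP.coinvariant i z hz) hx
  · by_cases h : i = j
    · subst h
      rw [hP.rowIsometry.inner_map_map]
      exact Submodule.inner_left_of_mem_orthogonal hz hx
    · exact hP.rowIsometry.2 i j h _ _

/-- `V_i` only sees the base component, when tested against `span (base, V (base ⊗ P))`. -/
theorem inner_map_eq_inner_map_starProjection (hP : P.IsWeakMarkov) (i : ι) (x : H) {y : H}
    (hy : y ∈ (P.base ⊔ P.imageSpan).topologicalClosure) :
    ⟪P.V i x, y⟫_ℂ = ⟪P.V i (P.base.starProjection x), y⟫_ℂ := by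
  have h := hP.inner_map_eq_zero_of_mem_orthogonal i
    (Submodule.sub_starProjection_mem_orthogonal (K := P.base) x) hy
  rw [map_sub, inner_sub_left] at h
  exact sub_eq_zero.1 h

/-- `E_*` is orthogonal to the ranges of all `V_i`. -/
theorem inner_map_wanderingStar (hP : P.IsWeakMarkov) (i : ι) (x : H) {η : H}
    (hη : η ∈ P.wanderingStar) : ⟪P.V i x, η⟫_ℂ = 0 := by
  rw [hP.inner_map_eq_inner_map_starProjection i x hη.1]
  exact Submodule.inner_right_of_mem_orthogonal
    (P.map_mem_imageSpan i (Submodule.starProjection_apply_mem _ _)) hη.2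

end IsWeakMarkov

end ProcessData

/-! ### Isometric extension of maps defined on the base of a process -/

/-- Two families of vectors with the same Gram matrix, the first of which is total, are related by
an isometry. -/
theorem exists_linearIsometry_of_inner_eq {X E F : Type*}
    [NormedAddCommGroup E] [InnerProductSpace ℂ E]
    [NormedAddCommGroup F] [InnerProductSpace ℂ F] [CompleteSpace F] (v : X → E) (w : X → F)
    (hv : (Submodule.span ℂ (Set.range v)).topologicalClosure = ⊤)
    (h : ∀ x y, ⟪v x, v y⟫_ℂ = ⟪w x, w y⟫_ℂ) : ∃ j : E →ₗᵢ[ℂ] F, ∀ x, j (v x) = w x := by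
  set e := Finsupp.linearCombination ℂ v
  set f := Finsupp.linearCombination ℂ w
  have hnorm : ∀ c, ‖f c‖ = ‖e c‖ := fun c => by
    rw [@norm_eq_sqrt_re_inner ℂ, @norm_eq_sqrt_re_inner ℂ]
    simp only [e, f, Finsupp.linearCombination_apply, Finsupp.sum_inner, Finsupp.inner_sum,
      inner_smul_left, inner_smul_right, h]
  have hdense : DenseRange e := by
    have h1 : Dense (LinearMap.range e : Set E) := by
      rw [Submodule.dense_iff_topologicalClosure_eq_top, Finsupp.range_linearCombination, hv]
    simpa [DenseRange] using! h1
  have hb : ∃ C : ℝ, ∀ c, ‖f c‖ ≤ C * ‖e c‖ := ⟨1, fun c => by rw [hnorm, one_mul]⟩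
  refine ⟨⟨(f.extendOfNorm e).toLinearMap, fun x => ?_⟩, fun x => ?_⟩
  · refine hdense.induction (P := fun x => ‖f.extendOfNorm e x‖ = ‖x‖) ?_
      (isClosed_eq (f.extendOfNorm e).continuous.norm continuous_norm) x
    rintro _ ⟨c, rfl⟩
    rw [LinearMap.extendOfNorm_eq hdense hb, hnorm]
  · have := LinearMap.extendOfNorm_eq hdense hb (Finsupp.single x 1)
    simpa [e, f] using! this

section Intertwining

variable {ι E F : Type*} [NormedAddCommGroup E] [InnerProductSpace ℂ E] [CompleteSpace E]
  [NormedAddCommGroup F] [InnerProductSpace ℂ F]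
  {P : ProcessData ι E} {W : ι → F →L[ℂ] F}

/-- A map on the base that reproduces the correlations `⟪x, V_α y⟫` of the process extends to an
intertwining isometry: these correlations determine the whole Gram matrix of the vectors
`V_α x`. -/
theorem ProcessData.IsWeakMarkov.exists_intertwining [CompleteSpace F] (hP : P.IsWeakMarkov)
    (hW : IsRowIsometry W) (c : P.base → F)
    (h : ∀ α x y, ⟪c x, wordOp W α (c y)⟫_ℂ = ⟪(x : E), wordOp P.V α y⟫_ℂ) :
    ∃ j : E →ₗᵢ[ℂ] F, (∀ x : P.base, j x = c x) ∧ ∀ i x, j (P.V i x) = W i (j x) := by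
  have gram : ∀ α β (x y : P.base),
      ⟪wordOp P.V α (x : E), wordOp P.V β (y : E)⟫_ℂ = ⟪wordOp W α (c x), wordOp W β (c y)⟫_ℂ := by
    intro α
    induction α with
    | nil => intro β x y; exact (h β x y).symm
    | cons i α ih =>
      rintro (_ | ⟨j, β⟩) x y
      · rw [← inner_conj_symm, ← inner_conj_symm (wordOp W (i :: α) (c x)), wordOp_nil, wordOp_nil,
          h]
      · simp only [wordOp_cons]
        by_cases hij : i = j
        · subst hij
          rw [hP.rowIsometry.inner_map_map, hW.inner_map_map, ih]
        · rw [hP.rowIsometry.2 i j hij, hW.2 i j hij]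
  set v : List ι × P.base → E := fun p => wordOp P.V p.1 p.2
  have hv : (Submodule.span ℂ (Set.range v)).topologicalClosure = ⊤ := by
    refine top_le_iff.1 (hP.minimal ▸ Submodule.topologicalClosure_mono (iSup_le fun α => ?_))
    rintro _ ⟨x, hx, rfl⟩
    exact Submodule.subset_span ⟨(α, ⟨x, hx⟩), rfl⟩
  obtain ⟨j, hj⟩ := exists_linearIsometry_of_inner_eq v (fun p => wordOp W p.1 (c p.2)) hv
    fun p q => gram _ _ _ _
  refine ⟨j, fun x => hj ([], x), fun i x => ?_⟩
  have hx : x ∈ (LinearMap.eqLocus ((j.toContinuousLinearMap ∘L P.V i).toLinearMap)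
      ((W i ∘L j.toContinuousLinearMap).toLinearMap)) := by
    refine Submodule.topologicalClosure_minimal (s := Submodule.span ℂ (Set.range v)) ?_ ?_ ?_
    · rw [Submodule.span_le]
      rintro _ ⟨⟨α, y⟩, rfl⟩
      change j (P.V i (v (α, y))) = W i (j (v (α, y)))
      have h1 := hj (i :: α, y)
      simp only [v, wordOp_cons] at h1
      rw [hj (α, y), h1]
    · exact isClosed_eq (j.toContinuousLinearMap ∘L P.V i).continuous
        (W i ∘L j.toContinuousLinearMap).continuous
    · rw [hv]; trivial
  exact hx

/-- The range of an intertwining isometry is generated by the image of the base. -/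
theorem ProcessData.IsWeakMarkov.range_eq_orbitSpan (hP : P.IsWeakMarkov) (j : E →ₗᵢ[ℂ] F)
    (hj : ∀ i x, j (P.V i x) = W i (j x)) :
    LinearMap.range j.toLinearMap = orbitSpan W (P.base.map j.toLinearMap) := by
  apply le_antisymm
  · have htop := hP.eq_top (N := (orbitSpan W (P.base.map j.toLinearMap)).comap j.toLinearMap)
      ((Submodule.isClosed_topologicalClosure _).preimage j.continuous)
      (fun x hx => le_orbitSpan W _ ⟨x, hx, rfl⟩)
      (fun i x hx => by
        change j (P.V i x) ∈ orbitSpan W _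
        rw [hj]
        exact map_mem_orbitSpan i hx)
    rintro _ ⟨x, rfl⟩
    have hx : x ∈ (⊤ : Submodule ℂ E) := trivial
    rw [← htop] at hx
    exact hx
  · refine orbitSpan_le ?_ ?_ ?_
    · have h1 : IsClosed (Set.range j) := j.isometry.isClosedEmbedding.isClosed_range
      exact h1
    · rintro _ ⟨x, -, rfl⟩
      exact ⟨x, rfl⟩
    · rintro i _ ⟨x, rfl⟩
      exact ⟨P.V i x, hj i x⟩

end Intertwining

/-! ### Morphisms and short exact sequences -/

section Morphisms

variable {ι 𝒢 ℋ 𝒦 : Type*}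
  [NormedAddCommGroup 𝒢] [InnerProductSpace ℂ 𝒢] [CompleteSpace 𝒢]
  [NormedAddCommGroup ℋ] [InnerProductSpace ℂ ℋ] [CompleteSpace ℋ]
  [NormedAddCommGroup 𝒦] [InnerProductSpace ℂ 𝒦] [CompleteSpace 𝒦]
  {G : ProcessData ι 𝒢} {H : ProcessData ι ℋ} {K : ProcessData ι 𝒦}

/-- A morphism intertwines the adjoints of all `V_α`. -/
theorem IsMorphism.intertwine_word {t : G.base →L[ℂ] H.base} (ht : IsMorphism G H t)
    (α : List ι) (x : G.base) : ∃ y : G.base,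
      (∀ z : 𝒢, ⟪(x : 𝒢), wordOp G.V α z⟫_ℂ = ⟪(y : 𝒢), z⟫_ℂ) ∧
      ∀ z : ℋ, ⟪(t x : ℋ), wordOp H.V α z⟫_ℂ = ⟪(t y : ℋ), z⟫_ℂ := by
  induction α generalizing x with
  | nil => exact ⟨x, fun _ => rfl, fun _ => rfl⟩
  | cons i α ih =>
    obtain ⟨y, hy, hty⟩ := ht.intertwine i x
    obtain ⟨w, hw, hw'⟩ := ih y
    refine ⟨w, fun z => ?_, fun z => ?_⟩
    · rw [wordOp_cons, ← ContinuousLinearMap.adjoint_inner_left, ← hy, hw]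
    · rw [wordOp_cons, ← ContinuousLinearMap.adjoint_inner_left, hty, hw']

theorem IsMorphism.inner_map {t : G.base →L[ℂ] H.base} (ht : IsMorphism G H t)
    (i : ι) (x : G.base) : ∃ y : G.base,
      (∀ z : 𝒢, ⟪(x : 𝒢), G.V i z⟫_ℂ = ⟪(y : 𝒢), z⟫_ℂ) ∧
      ∀ z : ℋ, ⟪(t x : ℋ), H.V i z⟫_ℂ = ⟪(t y : ℋ), z⟫_ℂ := by
  simpa using ht.intertwine_word [i] x

omit [CompleteSpace 𝒢] [CompleteSpace ℋ] in
theorem inner_map_map_of_isometry {t : G.base →L[ℂ] H.base} (ht : Isometry t) (x y : G.base) :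
    ⟪t x, t y⟫_ℂ = ⟪x, y⟫_ℂ :=
  LinearIsometry.inner_map_map
    ⟨t.toLinearMap, (AddMonoidHomClass.isometry_iff_norm t).1 ht⟩ x y

/-- An isometric morphism extends to an isometry that intertwines the row operators. -/
theorem IsMorphism.exists_intertwining (hG : G.IsWeakMarkov) (hH : IsRowIsometry H.V)
    {t : G.base →L[ℂ] H.base} (ht : IsMorphism G H t) (hiso : Isometry t) :
    ∃ j : 𝒢 →ₗᵢ[ℂ] ℋ, (∀ x : G.base, j x = t x) ∧ ∀ i x, j (G.V i x) = H.V i (j x) := by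
  refine hG.exists_intertwining hH (fun x => (t x : ℋ)) fun α x y => ?_
  obtain ⟨z, hz, hz'⟩ := ht.intertwine_word α x
  rw [hz, hz']
  exact inner_map_map_of_isometry hiso z y

/-- The inverse of a unitary morphism is a morphism. -/
theorem IsMorphism.symm {j : G.base ≃ₗᵢ[ℂ] H.base}
    (hj : IsMorphism G H (j : G.base →L[ℂ] H.base)) :
    IsMorphism H G (j.symm : H.base →L[ℂ] G.base) := by
  refine ⟨ContinuousLinearMap.opNorm_le_bound _ zero_le_one fun x => ?_, fun i x => ?_⟩
  · rw [one_mul]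
    exact (j.symm.norm_map x).le
  · obtain ⟨y, hy, hjy⟩ := hj.intertwine i (j.symm x)
    refine ⟨j y, ?_, ?_⟩
    · have h1 : ((j : G.base →L[ℂ] H.base) (j.symm x)) = x := j.apply_symm_apply x
      rw [h1] at hjy
      exact hjy.symm
    · have h1 : ((j.symm : H.base →L[ℂ] G.base) (j y)) = y := j.symm_apply_apply y
      rw [h1, hy]
      rfl

namespace IsShortExact

variable {a : G.base →L[ℂ] H.base} {b : H.base →L[ℂ] K.base}

theorem map_adjoint (h : IsShortExact G H K a b) (k : K.base) :
    b (ContinuousLinearMap.adjoint b k) = k :=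
  DFunLike.congr_fun h.coisometric k

theorem map_map (h : IsShortExact G H K a b) (g : G.base) : b (a g) = 0 := by
  have h1 : a g ∈ LinearMap.range a.toLinearMap := ⟨g, rfl⟩
  rw [h.exact] at h1
  exact h1

theorem inner_adjoint_adjoint (h : IsShortExact G H K a b) (k k' : K.base) :
    ⟪ContinuousLinearMap.adjoint b k, ContinuousLinearMap.adjoint b k'⟫_ℂ = ⟪k, k'⟫_ℂ := by
  rw [ContinuousLinearMap.adjoint_inner_left, h.map_adjoint]

theorem inner_map_adjoint (h : IsShortExact G H K a b) (g : G.base) (k : K.base) :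
    ⟪a g, ContinuousLinearMap.adjoint b k⟫_ℂ = 0 := by
  rw [ContinuousLinearMap.adjoint_inner_right, h.map_map, inner_zero_left]

/-- In a short exact sequence the base of the middle term is `a(𝔤) ⊕ b^*(𝔨)`. -/
theorem exists_eq_map_add_adjoint (h : IsShortExact G H K a b) (x : H.base) :
    ∃ g : G.base, x = a g + ContinuousLinearMap.adjoint b (b x) := by
  have h1 : x - ContinuousLinearMap.adjoint b (b x) ∈ LinearMap.ker b.toLinearMap := by
    change b (x - ContinuousLinearMap.adjoint b (b x)) = 0
    rw [map_sub, h.map_adjoint, sub_self]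
  rw [← h.exact] at h1
  obtain ⟨g, hg⟩ := h1
  exact ⟨g, by rw [show a g = _ from hg, sub_add_cancel]⟩

/-- `b^*` extends to an intertwining isometry of the quotient into the middle term, although it is
in general not a morphism. -/
theorem exists_intertwining_adjoint (h : IsShortExact G H K a b) (hK : K.IsWeakMarkov)
    (hH : IsRowIsometry H.V) :
    ∃ j : 𝒦 →ₗᵢ[ℂ] ℋ, (∀ x : K.base, j x = (ContinuousLinearMap.adjoint b x : H.base)) ∧
      ∀ i x, j (K.V i x) = H.V i (j x) := by
  refine hK.exists_intertwining hH
    (fun x => ((ContinuousLinearMap.adjoint b x : H.base) : ℋ)) fun α x y => ?_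
  obtain ⟨z, hz, hz'⟩ := h.morphism_right.intertwine_word α (ContinuousLinearMap.adjoint b x)
  rw [h.map_adjoint] at hz'
  rw [hz, hz']
  exact ContinuousLinearMap.adjoint_inner_right b z y

/-- `a(𝔤)` is orthogonal to `V_i b^*(𝔨)`, by co-invariance of `a(𝔤)`. -/
theorem inner_map_V_adjoint (h : IsShortExact G H K a b) (i : ι) (g : G.base) (k : K.base) :
    ⟪(a g : ℋ), H.V i (ContinuousLinearMap.adjoint b k : H.base)⟫_ℂ = 0 := by
  obtain ⟨y, -, hy⟩ := h.morphism_left.inner_map i g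
  rw [hy]
  exact h.inner_map_adjoint y k

end IsShortExact

end Morphisms

/-! ### Inner products, adjoints and projections -/

theorem norm_adjoint_le {A B : Type*}
    [NormedAddCommGroup A] [InnerProductSpace ℂ A] [CompleteSpace A]
    [NormedAddCommGroup B] [InnerProductSpace ℂ B] [CompleteSpace B] {T : A →L[ℂ] B}
    (hT : ‖T‖ ≤ 1) : ‖ContinuousLinearMap.adjoint T‖ ≤ 1 :=
  (LinearIsometryEquiv.norm_map ContinuousLinearMap.adjoint T).trans_le hT

theorem inner_add_add_of_inner_eq_zero {E : Type*} [NormedAddCommGroup E] [InnerProductSpace ℂ E]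
    {x y x' y' : E} (h : ⟪x, y'⟫_ℂ = 0) (h' : ⟪y, x'⟫_ℂ = 0) :
    ⟪x + y, x' + y'⟫_ℂ = ⟪x, x'⟫_ℂ + ⟪y, y'⟫_ℂ := by
  rw [inner_add_left, inner_add_right, inner_add_right, h, h', add_zero, zero_add]

theorem norm_le_norm_of_inner_eq_add {E F F' : Type*}
    [NormedAddCommGroup E] [InnerProductSpace ℂ E] [NormedAddCommGroup F] [InnerProductSpace ℂ F]
    [NormedAddCommGroup F'] [InnerProductSpace ℂ F'] {x : E} {y : F} {z : F'}
    (h : ⟪x, x⟫_ℂ = ⟪y, y⟫_ℂ + ⟪z, z⟫_ℂ) : ‖z‖ ≤ ‖x‖ := by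
  have h1 := congrArg RCLike.re h
  rw [map_add, inner_self_eq_norm_sq, inner_self_eq_norm_sq, inner_self_eq_norm_sq] at h1
  exact le_of_sq_le_sq (h1 ▸ le_add_of_nonneg_left (sq_nonneg _)) (norm_nonneg _)

/-- A vector `z` with `⟪j x, z⟫ = ⟪x, y⟫` for all `x` is projected to `j y` by the projection onto
the image of any closed subspace containing `y`. -/
theorem imageProj_eq {E F : Type*} [NormedAddCommGroup E] [InnerProductSpace ℂ E]
    [NormedAddCommGroup F] [InnerProductSpace ℂ F] {j : E →ₗᵢ[ℂ] F} {s : Submodule ℂ E}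
    [CompleteSpace s] {y : E} {z : F} (hy : y ∈ s) (h : ∀ x, ⟪j x, z⟫_ℂ = ⟪x, y⟫_ℂ) :
    imageProj j s z = j y := by
  have : CompleteSpace (s.map j.toLinearMap) := LinearIsometry.completeSpace_map j s
  refine Submodule.eq_starProjection_of_mem_orthogonal ⟨y, hy, rfl⟩ ?_
  rintro _ ⟨x, -, rfl⟩
  change ⟪j x, z - j y⟫_ℂ = 0
  rw [inner_sub_right, h, j.inner_map_map, sub_self]

/-! ### Defect operators and the row shift -/

/-- `T^* T + D_T^2 = 1` for a contraction `T`. -/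
theorem inner_add_inner_toDefectSpace {A B : Type*}
    [NormedAddCommGroup A] [InnerProductSpace ℂ A] [CompleteSpace A]
    [NormedAddCommGroup B] [InnerProductSpace ℂ B] [CompleteSpace B] {T : A →L[ℂ] B}
    (hT : ‖T‖ ≤ 1) (x y : A) :
    ⟪T x, T y⟫_ℂ + ⟪toDefectSpace T x, toDefectSpace T y⟫_ℂ = ⟪x, y⟫_ℂ := by
  have hpos : 0 ≤ 1 - ContinuousLinearMap.adjoint T ∘L T := by
    rw [ContinuousLinearMap.nonneg_iff_isPositive, ContinuousLinearMap.isPositive_iff_complex]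
    intro x
    have h1 : ⟪(1 - ContinuousLinearMap.adjoint T ∘L T) x, x⟫_ℂ
        = ((‖x‖ ^ 2 - ‖T x‖ ^ 2 : ℝ) : ℂ) := by
      simp only [sub_apply, one_apply_eq_self, ContinuousLinearMap.comp_apply, inner_sub_left,
        ContinuousLinearMap.adjoint_inner_left,
        inner_self_eq_norm_sq_to_K]
      push_cast
      rfl
    have h2 : ‖T x‖ ≤ ‖x‖ := by simpa using T.le_of_opNorm_le hT x
    have hre : RCLike.re (((‖x‖ ^ 2 - ‖T x‖ ^ 2 : ℝ) : ℂ)) = ‖x‖ ^ 2 - ‖T x‖ ^ 2 :=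
      Complex.ofReal_re _
    rw [h1]
    refine ⟨by rw [hre], ?_⟩
    rw [hre, sub_nonneg]
    gcongr
  have hsq : defectOp T * defectOp T = 1 - ContinuousLinearMap.adjoint T ∘L T :=
    CFC.sqrt_mul_sqrt_self _ hpos
  have hadj : ContinuousLinearMap.adjoint (defectOp T) = defectOp T :=
    (IsSelfAdjoint.of_nonneg (CFC.sqrt_nonneg _)).adjoint_eq
  have h1 : ⟪toDefectSpace T x, toDefectSpace T y⟫_ℂ = ⟪x, (defectOp T * defectOp T) y⟫_ℂ := by
    change ⟪defectOp T x, defectOp T y⟫_ℂ = ⟪x, defectOp T (defectOp T y)⟫_ℂ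
    rw [← ContinuousLinearMap.adjoint_inner_left (defectOp T) _ x, hadj]
  rw [h1, hsq, sub_apply, inner_sub_right, ContinuousLinearMap.comp_apply,
    ContinuousLinearMap.adjoint_inner_right]
  simp

/-- The range of the defect operator is total in the defect space. -/
theorem eq_top_of_toDefectSpace_mem {A B : Type*}
    [NormedAddCommGroup A] [InnerProductSpace ℂ A] [CompleteSpace A]
    [NormedAddCommGroup B] [InnerProductSpace ℂ B] [CompleteSpace B] {T : A →L[ℂ] B}
    {N : Submodule ℂ (defectSpace T)} (hN : IsClosed (N : Set (defectSpace T)))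
    (h : ∀ x, toDefectSpace T x ∈ N) : N = ⊤ := by
  have : CompleteSpace N := hN.completeSpace_coe
  rw [← Submodule.orthogonal_eq_bot_iff, Submodule.eq_bot_iff]
  intro w hw
  have h1 : (w : A) ∈ (defectSpace T)ᗮ := by
    change (w : A) ∈ (LinearMap.range (defectOp T).toLinearMap).topologicalClosureᗮ
    rw [Submodule.orthogonal_closure]
    rintro _ ⟨x, rfl⟩
    exact hw _ (h x)
  have h2 : ⟪(w : A), (w : A)⟫_ℂ = 0 := h1 w w.2
  exact Subtype.ext (inner_self_eq_zero.1 h2)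

section Shift

variable {ι D : Type*} [NormedAddCommGroup D] [InnerProductSpace ℂ D]

theorem rowShift_apply_nil (i : ι) (x : WordSum ι D) : rowShift i x [] = 0 :=
  Function.extend_apply' _ _ _ (by simp)

theorem rowShift_apply_cons_self (i : ι) (x : WordSum ι D) (α : List ι) :
    rowShift i x (i :: α) = x α :=
  (List.cons_injective (a := i)).extend_apply _ _ _

theorem rowShift_apply_cons_of_ne {i j : ι} (h : i ≠ j) (x : WordSum ι D) (α : List ι) :
    rowShift i x (j :: α) = 0 :=
  Function.extend_apply' _ _ _ (by simp [h])

theorem inner_rowShift_of_ne {i j : ι} (h : i ≠ j) (x y : WordSum ι D) :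
    ⟪rowShift i x, rowShift j y⟫_ℂ = 0 := by
  rw [lp.inner_eq_tsum]
  refine (tsum_congr fun α => ?_).trans tsum_zero
  rcases α with _ | ⟨k, α⟩
  · rw [rowShift_apply_nil, inner_zero_left]
  · by_cases hk : i = k
    · subst hk
      rw [rowShift_apply_cons_of_ne h.symm, inner_zero_right]
    · rw [rowShift_apply_cons_of_ne hk, inner_zero_left]

theorem rowShift_single [DecidableEq (List ι)] (i : ι) (α : List ι) (d : D) :
    rowShift i (lp.single 2 α d : WordSum ι D) = lp.single 2 (i :: α) d := by
  ext β
  rw [lp.single_apply]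
  rcases β with _ | ⟨k, β⟩
  · rw [rowShift_apply_nil, Pi.single_eq_of_ne (by simp)]
  · by_cases hk : i = k
    · subst hk
      rw [rowShift_apply_cons_self, lp.single_apply]
      by_cases hβ : β = α
      · subst hβ; simp
      · rw [Pi.single_eq_of_ne hβ, Pi.single_eq_of_ne (by simp [hβ])]
    · rw [rowShift_apply_cons_of_ne hk, Pi.single_eq_of_ne (by simp [Ne.symm hk])]

end Shift

/-! ### The cascade as a process -/

section Cascade

variable {ι 𝒢 𝒦 : Type*}
  [NormedAddCommGroup 𝒢] [InnerProductSpace ℂ 𝒢] [CompleteSpace 𝒢]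
  [NormedAddCommGroup 𝒦] [InnerProductSpace ℂ 𝒦] [CompleteSpace 𝒦]
  {G : ProcessData ι 𝒢} {K : ProcessData ι 𝒦} {γ : K.wanderingStar →L[ℂ] G.wandering}

namespace Cascade

/-- The element `(g, k, d)` of the cascade space, in curried form. -/
noncomputable def elt (γ : K.wanderingStar →L[ℂ] G.wandering) (g : G.base) (k : 𝒦)
    (d : CascadeDefect G K γ) : CascadeSpace G K γ :=
  mk G K γ (g, k, d)

theorem exists_eq_elt (x : CascadeSpace G K γ) : ∃ g k d, x = elt γ g k d :=
  ⟨fstL G K γ x, sndL G K γ x, thdL G K γ x, rfl⟩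

theorem inner_elt (g g' : G.base) (k k' : 𝒦) (d d' : CascadeDefect G K γ) :
    ⟪elt γ g k d, elt γ g' k' d'⟫_ℂ = ⟪(g : 𝒢), g'⟫_ℂ + (⟪k, k'⟫_ℂ + ⟪d, d'⟫_ℂ) := rfl

theorem elt_add (g g' : G.base) (k k' : 𝒦) (d d' : CascadeDefect G K γ) :
    elt γ g k d + elt γ g' k' d' = elt γ (g + g') (k + k') (d + d') := rfl

theorem V_elt (i : ι) (g : G.base) (k : 𝒦) (d : CascadeDefect G K γ) :
    V G K γ i (elt γ g k d) = elt γ (G.base.orthogonalProjectionOnto (G.V i g))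
      ((ContinuousLinearMap.adjoint γ (wanderingPart G i g) : 𝒦) + K.V i k)
      (defectZero G K γ (toDefectSpace (ContinuousLinearMap.adjoint γ) (wanderingPart G i g))
        + rowShift i d) := rfl

theorem V_elt_fst (i : ι) (g : G.base) :
    V G K γ i (elt γ g 0 0) = elt γ (G.base.orthogonalProjectionOnto (G.V i g))
      (ContinuousLinearMap.adjoint γ (wanderingPart G i g))
      (defectZero G K γ (toDefectSpace (ContinuousLinearMap.adjoint γ) (wanderingPart G i g))) := by
  rw [V_elt]
  congr 1 <;> simp

theorem V_elt_snd (i : ι) (k : 𝒦) : V G K γ i (elt γ 0 k 0) = elt γ 0 (K.V i k) 0 := by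
  rw [V_elt]
  congr 1 <;> simp

theorem V_elt_thd (i : ι) (d : CascadeDefect G K γ) :
    V G K γ i (elt γ 0 0 d) = elt γ 0 0 (rowShift i d) := by
  rw [V_elt]
  congr 1 <;> simp

theorem elt_mem_base {g : G.base} {k : 𝒦} {d : CascadeDefect G K γ} :
    elt γ g k d ∈ base G K γ ↔ k ∈ K.base ∧ d = 0 := Iff.rfl

theorem inner_defectZero_left (d : defectSpace (ContinuousLinearMap.adjoint γ))
    (x : CascadeDefect G K γ) : ⟪defectZero G K γ d, x⟫_ℂ = ⟪d, x []⟫_ℂ := by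
  classical
  exact lp.inner_single_left _ _ _

theorem inner_defectZero (d d' : defectSpace (ContinuousLinearMap.adjoint γ)) :
    ⟪defectZero G K γ d, defectZero G K γ d'⟫_ℂ = ⟪d, d'⟫_ℂ := by
  rw [inner_defectZero_left]
  congr 1

theorem inner_defectZero_rowShift (d : defectSpace (ContinuousLinearMap.adjoint γ)) (i : ι)
    (x : CascadeDefect G K γ) : ⟪defectZero G K γ d, rowShift i x⟫_ℂ = 0 := by
  rw [inner_defectZero_left, rowShift_apply_nil, inner_zero_right]

theorem inner_rowShift_defectZero (d : defectSpace (ContinuousLinearMap.adjoint γ)) (i : ι)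
    (x : CascadeDefect G K γ) : ⟪rowShift i x, defectZero G K γ d⟫_ℂ = 0 := by
  rw [← inner_conj_symm, inner_defectZero_rowShift, map_zero]

/-- `V_i^G g = P_𝔤 V_i^G g + P_{E^𝔤} V_i^G g` is an orthogonal decomposition. -/
theorem inner_projection_add_inner_wanderingPart (i j : ι) (g g' : G.base) :
    ⟪G.base.orthogonalProjectionOnto (G.V i g), G.base.orthogonalProjectionOnto (G.V j g')⟫_ℂ
      + ⟪wanderingPart G i g, wanderingPart G j g'⟫_ℂ = ⟪G.V i g, G.V j g'⟫_ℂ := by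
  have h1 := Submodule.inner_orthogonalProjectionOnto_eq_of_mem_right (K := G.base)
    (G.base.orthogonalProjectionOnto (G.V j g')) (G.V i g)
  have h2 : ⟪wanderingPart G i g, wanderingPart G j g'⟫_ℂ
      = ⟪G.V i g, (wanderingPart G j g' : 𝒢)⟫_ℂ :=
    Submodule.inner_orthogonalProjectionOnto_eq_of_mem_right (K := G.wandering)
      (wanderingPart G j g') (G.V i g)
  rw [h1, h2, ← inner_add_right]
  congr 1
  exact ProcessData.starProjection_base_add_starProjection_wandering (G.map_mem_closure j g'.2)

/-- The inner product relations of the row operator of the cascade; the contributions of `E^𝔤` to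
the second and third component add up to the inner product in `E^𝔤` because
`γ γ^* + D_{γ^*}^2 = 1`. -/
theorem inner_V_elt (hK : K.IsWeakMarkov) (hγ : ‖γ‖ ≤ 1) (i j : ι) (g g' : G.base) (k k' : 𝒦)
    (d d' : CascadeDefect G K γ) :
    ⟪V G K γ i (elt γ g k d), V G K γ j (elt γ g' k' d')⟫_ℂ = ⟪G.V i g, G.V j g'⟫_ℂ
      + (⟪K.V i k, K.V j k'⟫_ℂ + ⟪rowShift i d, rowShift j d'⟫_ℂ) := by
  have h1 := inner_add_inner_toDefectSpace (norm_adjoint_le hγ)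
    (wanderingPart G i g) (wanderingPart G j g')
  have h2 := inner_projection_add_inner_wanderingPart i j g g'
  have h3 : ∀ (l : ι) (k : 𝒦) (η : K.wanderingStar), ⟪K.V l k, (η : 𝒦)⟫_ℂ = 0 :=
    fun l k η => hK.inner_map_wanderingStar l k η.2
  have h4 : ∀ (l : ι) (k : 𝒦) (η : K.wanderingStar), ⟪(η : 𝒦), K.V l k⟫_ℂ = 0 :=
    fun l k η => inner_eq_zero_symm.1 (h3 l k η)
  have h5 := inner_add_add_of_inner_eq_zero
    (h4 j k' (ContinuousLinearMap.adjoint γ (wanderingPart G i g)))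
    (h3 i k (ContinuousLinearMap.adjoint γ (wanderingPart G j g')))
  have h6 := inner_add_add_of_inner_eq_zero
    (inner_defectZero_rowShift
      (toDefectSpace (ContinuousLinearMap.adjoint γ) (wanderingPart G i g)) j d')
    (inner_rowShift_defectZero
      (toDefectSpace (ContinuousLinearMap.adjoint γ) (wanderingPart G j g')) i d)
  have e1 := V_elt (γ := γ) i g k d
  have e2 := V_elt (γ := γ) j g' k' d'
  have key : ∀ {s t r r₁ r₂ u u' w w' : ℂ}, u = r₁ + u' → w = r₂ + w' → r₁ + r₂ = r → s + r = t →
      s + (u + w) = t + (u' + w') := by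
    rintro s _ _ r₁ r₂ _ u' _ w' rfl rfl rfl rfl
    ring
  have e3 := congrArg₂ (fun x y : CascadeSpace G K γ => ⟪x, y⟫_ℂ) e1 e2
  refine e3.trans ((inner_elt _ _ _ _ _ _).trans ?_)
  exact key h5 (h6.trans (congrArg (· + _) (inner_defectZero _ _))) h1 h2

theorem isRowIsometry (hG : G.IsWeakMarkov) (hK : K.IsWeakMarkov) (hγ : ‖γ‖ ≤ 1) :
    IsRowIsometry (V G K γ) := by
  have key : ∀ {r s t r' s' t' : ℂ}, r = r' → s = s' → t = t' → r + (s + t) = r' + (s' + t') := by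
    rintro _ _ _ _ _ _ rfl rfl rfl
    rfl
  refine isRowIsometry_of_inner (fun i x y => ?_) fun i j hij x y => ?_
  all_goals
    obtain ⟨g, k, d, rfl⟩ := exists_eq_elt x
    obtain ⟨g', k', d', rfl⟩ := exists_eq_elt y
  · exact (inner_V_elt hK hγ i i g g' k k' d d').trans
      ((key (hG.rowIsometry.inner_map_map i g g') (hK.rowIsometry.inner_map_map i k k')
        ((rowShift i).inner_map_map d d')).trans (inner_elt g g' k k' d d').symm)
  · refine (inner_V_elt hK hγ i j g g' k k' d d').trans
      ((key (hG.rowIsometry.2 i j hij g g') (hK.rowIsometry.2 i j hij k k')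
        (inner_rowShift_of_ne hij d d')).trans ?_)
    rw [add_zero, add_zero]

/-- `V_i^*` acts on `𝔤 ⊕ 𝒦` as `V_i^{K*}` in the second component. -/
theorem exists_adjoint_V_elt (i : ι) (g : G.base) (k : 𝒦) : ∃ g' : G.base,
    ContinuousLinearMap.adjoint (V G K γ i) (elt γ g k 0)
      = elt γ g' (ContinuousLinearMap.adjoint (K.V i) k) 0 := by
  obtain ⟨g', k', d', h⟩ := exists_eq_elt (ContinuousLinearMap.adjoint (V G K γ i) (elt γ g k 0))
  have h1 : ∀ y, ⟪elt γ g' k' d', y⟫_ℂ = ⟪elt γ g k 0, V G K γ i y⟫_ℂ := fun y => by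
    rw [← h, ContinuousLinearMap.adjoint_inner_left]
  have hk : k' = ContinuousLinearMap.adjoint (K.V i) k := by
    refine ext_inner_right ℂ fun y => ?_
    have h2 := h1 (elt γ 0 y 0)
    rw [V_elt_snd, inner_elt, inner_elt] at h2
    simpa [ContinuousLinearMap.adjoint_inner_left] using h2
  have hd : d' = 0 := by
    refine ext_inner_right ℂ fun y => ?_
    have h2 := h1 (elt γ 0 0 y)
    rw [V_elt_thd, inner_elt, inner_elt] at h2
    simpa using h2
  exact ⟨g', by rw [h, hk, hd]⟩

theorem isCoinvariant (hK : K.IsWeakMarkov) : IsCoinvariant (V G K γ) (base G K γ) := by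
  intro i x hx
  obtain ⟨g, k, d, rfl⟩ := exists_eq_elt x
  obtain ⟨hk, rfl⟩ := elt_mem_base.1 hx
  obtain ⟨g', h⟩ := exists_adjoint_V_elt (γ := γ) i g k
  rw [h]
  exact elt_mem_base.2 ⟨hK.coinvariant i _ hk, rfl⟩

/-- On `𝔤`, `V_i^*` acts as `V_i^{G*}`. -/
theorem adjoint_V_elt_fst (hG : G.IsWeakMarkov) (i : ι) (g : G.base) :
    ContinuousLinearMap.adjoint (V G K γ i) (elt γ g 0 0) =
      elt γ ⟨ContinuousLinearMap.adjoint (G.V i) g, hG.coinvariant i g g.2⟩ 0 0 := by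
  obtain ⟨g', h⟩ := exists_adjoint_V_elt (γ := γ) i g 0
  rw [map_zero] at h
  have hg : g' = ⟨ContinuousLinearMap.adjoint (G.V i) g, hG.coinvariant i g g.2⟩ := by
    refine ext_inner_right ℂ fun y => ?_
    have h1 : ⟪elt γ g' 0 0, elt γ y 0 0⟫_ℂ = ⟪elt γ g 0 0, V G K γ i (elt γ y 0 0)⟫_ℂ := by
      rw [← h, ContinuousLinearMap.adjoint_inner_left]
    rw [V_elt_fst, inner_elt, inner_elt] at h1
    simp only [inner_zero_left, add_zero] at h1
    rw [Submodule.coe_inner, Submodule.coe_inner, h1, ContinuousLinearMap.adjoint_inner_left]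
    exact Submodule.inner_orthogonalProjectionOnto_eq_of_mem_left g (G.V i y)
  rw [h, hg]

/-- The embedding of the direct sum of the defect spaces as the third summand. -/
noncomputable def inclDefect (γ : K.wanderingStar →L[ℂ] G.wandering) :
    CascadeDefect G K γ →L[ℂ] CascadeSpace G K γ :=
  mk G K γ ∘L ContinuousLinearMap.inr ℂ _ _ ∘L ContinuousLinearMap.inr ℂ _ _

theorem elt_eq_add (g : G.base) (k : 𝒦) (d : CascadeDefect G K γ) :
    elt γ g k d = elt γ g 0 0 + (elt γ 0 k 0 + elt γ 0 0 d) := by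
  have h1 := elt_add (γ := γ) 0 0 k 0 0 d
  have h2 := elt_add (γ := γ) g (0 + 0) 0 (k + 0) 0 (0 + d)
  refine Eq.trans ?_ ((congrArg (elt γ g 0 0 + ·) h1).trans h2).symm
  congr 1 <;> simp

/-- A closed `V`-invariant subspace that contains `𝔥` is everything: it contains `𝒦` by minimality
of `𝒦`, hence the vectors `(D_{γ^*} P_{E^𝔤} V_i g)_0`, which are total in `(D_{γ^*})_0`, and hence
all `(D_{γ^*})_α`. -/
theorem eq_top (hK : K.IsWeakMarkov) {N : Submodule ℂ (CascadeSpace G K γ)}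
    (hN : IsClosed (N : Set (CascadeSpace G K γ))) (h0 : base G K γ ≤ N)
    (hV : ∀ i, ∀ x ∈ N, V G K γ i x ∈ N) : N = ⊤ := by
  have hg : ∀ g : G.base, elt γ g 0 0 ∈ N := fun g => h0 (elt_mem_base.2 ⟨zero_mem _, rfl⟩)
  have hk : ∀ k : 𝒦, elt γ 0 k 0 ∈ N := fun k => by
    have htop := hK.eq_top (N := N.comap (inclK G K γ).toLinearMap)
      (hN.preimage (inclK G K γ).continuous) (fun k hk => h0 (elt_mem_base.2 ⟨hk, rfl⟩))
      (fun i k hk => by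
        have h1 := hV i _ hk
        have h2 := V_elt_snd (γ := γ) i k
        change elt γ 0 (K.V i k) 0 ∈ N
        exact Set.mem_of_eq_of_mem h2.symm h1)
    have h1 : k ∈ (⊤ : Submodule ℂ 𝒦) := trivial
    rw [← htop] at h1
    exact h1
  have hξ : ∀ ξ, inclDefect γ (defectZero G K γ
      (toDefectSpace (ContinuousLinearMap.adjoint γ) ξ)) ∈ N := fun ξ => by
    set L := inclDefect γ ∘L defectZero G K γ ∘L toDefectSpace (ContinuousLinearMap.adjoint γ)
    have htop := ProcessData.wandering_eq_top (N := N.comap L.toLinearMap)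
      (hN.preimage L.continuous) (fun i x hx => by
        have h1 := hV i _ (hg ⟨x, hx⟩)
        have h2 := V_elt_fst (γ := γ) i ⟨x, hx⟩
        have h3 := h2.trans (elt_eq_add _ _ _)
        have h4 := Set.mem_of_eq_of_mem h3.symm h1
        exact (N.add_mem_iff_right (hk _)).1 ((N.add_mem_iff_right (hg _)).1 h4))
    have h1 : ξ ∈ (⊤ : Submodule ℂ G.wandering) := trivial
    rw [← htop] at h1
    exact h1
  have hd : ∀ d, inclDefect γ (defectZero G K γ d) ∈ N := fun d => by
    set L := inclDefect γ ∘L defectZero G K γ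
    have htop := eq_top_of_toDefectSpace_mem (N := N.comap L.toLinearMap)
      (hN.preimage L.continuous) hξ
    have h1 : d ∈ (⊤ : Submodule ℂ (defectSpace (ContinuousLinearMap.adjoint γ))) := trivial
    rw [← htop] at h1
    exact h1
  classical
  have hα : ∀ (α : List ι) (d : defectSpace (ContinuousLinearMap.adjoint γ)),
      inclDefect γ (lp.single 2 α d) ∈ N := fun α d => by
    induction α with
    | nil => exact hd d
    | cons i α ih =>
      have h1 := hV i _ ih
      have h2 := V_elt_thd (γ := γ) i (lp.single 2 α d)
      have h3 := congrArg (inclDefect γ) (rowShift_single i α d)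
      exact Set.mem_of_eq_of_mem (h3.symm.trans h2.symm) h1
  have hd' : ∀ d, elt γ 0 0 d ∈ N := fun d => by
    have h1 : IsClosed (N.comap (inclDefect γ).toLinearMap : Set (CascadeDefect G K γ)) :=
      hN.preimage (inclDefect γ).continuous
    refine h1.mem_of_tendsto (lp.hasSum_single (by simp) d)
      (Filter.Eventually.of_forall fun s => ?_)
    exact Submodule.sum_mem _ fun α _ => hα α _
  refine (Submodule.eq_top_iff').2 fun x => ?_
  obtain ⟨g, k, d, rfl⟩ := exists_eq_elt x
  have h1 := N.add_mem (hg g) (N.add_mem (hk k) (hd' d))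
  exact Set.mem_of_eq_of_mem (elt_eq_add g k d) h1

end Cascade

open Cascade

theorem isWeakMarkov_cascade (hG : G.IsWeakMarkov) (hK : K.IsWeakMarkov) (hγ : ‖γ‖ ≤ 1) :
    (cascade G K γ).IsWeakMarkov where
  rowIsometry := Cascade.isRowIsometry hG hK hγ
  coinvariant := Cascade.isCoinvariant hK
  minimal := Cascade.eq_top hK (Submodule.isClosed_topologicalClosure _)
    (le_orbitSpan (V G K γ) _) fun i _ hx => map_mem_orbitSpan (V := V G K γ) i hx

/-- By minimality the space of the cascade is generated by the countably many images `V_α 𝔥` of the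
separable subspace `𝔥`. -/
theorem separableSpace_cascade [Countable ι] [TopologicalSpace.SeparableSpace 𝒢]
    [TopologicalSpace.SeparableSpace 𝒦]
    (h : orbitSpan (cascade G K γ).V (cascade G K γ).base = ⊤) :
    TopologicalSpace.SeparableSpace (CascadeSpace G K γ) := by
  rw [← TopologicalSpace.isSeparable_univ_iff]
  have hb : TopologicalSpace.IsSeparable ((cascade G K γ).base : Set (CascadeSpace G K γ)) := by
    have : SecondCountableTopology 𝒢 := UniformSpace.secondCountable_of_separable 𝒢
    have hc : Continuous fun p : G.base × 𝒦 => elt γ p.1 p.2 0 :=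
      (mk G K γ).continuous.comp (by fun_prop)
    refine (TopologicalSpace.isSeparable_range hc).mono ?_
    intro x hx
    obtain ⟨g, k, d, rfl⟩ := exists_eq_elt x
    obtain ⟨-, rfl⟩ := elt_mem_base.1 hx
    exact ⟨(g, k), rfl⟩
  have hu : TopologicalSpace.IsSeparable
      (⋃ α : List ι, wordOp (cascade G K γ).V α '' (cascade G K γ).base) :=
    TopologicalSpace.IsSeparable.iUnion fun α => hb.image (wordOp (cascade G K γ).V α).continuous
  refine (hu.span (R := ℂ)).closure.mono ?_
  rw [← Submodule.topologicalClosure_coe]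
  have hle : orbitSpan (cascade G K γ).V (cascade G K γ).base ≤ (Submodule.span ℂ
      (⋃ α : List ι, wordOp (cascade G K γ).V α '' (cascade G K γ).base)).topologicalClosure := by
    refine Submodule.topologicalClosure_mono (iSup_le fun α => ?_)
    rintro _ ⟨x, hx, rfl⟩
    exact Submodule.subset_span (Set.mem_iUnion.2 ⟨α, x, hx, rfl⟩)
  rw [h] at hle
  exact fun x _ => hle trivial

/-! ### The cascade as an extension -/

namespace Cascade

theorem norm_elt_fst (g : G.base) : ‖elt γ g 0 0‖ = ‖g‖ := by
  have h : ⟪elt γ g 0 0, elt γ g 0 0⟫_ℂ = ⟪g, g⟫_ℂ :=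
    (inner_elt g g 0 0 0 0).trans (by simp)
  rw [@norm_eq_sqrt_re_inner ℂ, @norm_eq_sqrt_re_inner ℂ, h]

theorem isometry_baseIncl : Isometry (baseIncl G K γ) :=
  (AddMonoidHomClass.isometry_iff_norm (baseIncl G K γ)).2 fun g => norm_elt_fst g

theorem isMorphism_baseIncl (hG : G.IsWeakMarkov) :
    IsMorphism G (cascade G K γ) (baseIncl G K γ) where
  contraction := ContinuousLinearMap.opNorm_le_bound _ zero_le_one fun g =>
    (norm_elt_fst g).le.trans (one_mul _).ge
  intertwine i g := ⟨⟨ContinuousLinearMap.adjoint (G.V i) g, hG.coinvariant i g g.2⟩, rfl,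
    adjoint_V_elt_fst hG i g⟩

theorem exists_base_eq_elt (x : (cascade G K γ).base) :
    ∃ (g : G.base) (k : K.base), x = ⟨elt γ g k 0, elt_mem_base.2 ⟨k.2, rfl⟩⟩ := by
  obtain ⟨x, hx⟩ := x
  obtain ⟨g, k, d, rfl⟩ := exists_eq_elt x
  obtain ⟨hk, rfl⟩ := elt_mem_base.1 hx
  exact ⟨g, ⟨k, hk⟩, rfl⟩

theorem norm_baseProj_le (x : (cascade G K γ).base) : ‖baseProj G K γ x‖ ≤ ‖x‖ := by
  obtain ⟨g, k, rfl⟩ := exists_base_eq_elt x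
  have h : ⟪elt γ g (k : 𝒦) 0, elt γ g (k : 𝒦) 0⟫_ℂ = ⟪(g : 𝒢), g⟫_ℂ + ⟪(k : 𝒦), k⟫_ℂ :=
    (inner_elt (γ := γ) g g k k 0 0).trans (by simp)
  exact norm_le_norm_of_inner_eq_add h

theorem isMorphism_baseProj (hK : K.IsWeakMarkov) :
    IsMorphism (cascade G K γ) K (baseProj G K γ) where
  contraction := ContinuousLinearMap.opNorm_le_bound _ zero_le_one fun x =>
    (norm_baseProj_le x).trans (one_mul _).ge
  intertwine i x := by
    obtain ⟨g, k, rfl⟩ := exists_base_eq_elt x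
    obtain ⟨g', h⟩ := exists_adjoint_V_elt (γ := γ) i g k
    exact ⟨⟨elt γ g' _ 0, elt_mem_base.2 ⟨hK.coinvariant i k k.2, rfl⟩⟩, h.symm, rfl⟩

/-- The adjoint of the projection `𝔤 ⊕ 𝔨 → 𝔨` is the inclusion of `𝔨`. -/
theorem adjoint_baseProj (k : K.base) : ContinuousLinearMap.adjoint (baseProj G K γ) k
    = ⟨elt γ 0 k 0, elt_mem_base.2 ⟨k.2, rfl⟩⟩ := by
  refine ext_inner_right ℂ fun x => ?_
  rw [ContinuousLinearMap.adjoint_inner_left]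
  obtain ⟨g, k', rfl⟩ := exists_base_eq_elt x
  have h : ⟪((0 : G.base) : 𝒢), (g : 𝒢)⟫_ℂ
      + (⟪(k : 𝒦), (k' : 𝒦)⟫_ℂ + ⟪(0 : CascadeDefect G K γ), 0⟫_ℂ) = ⟪k, k'⟫_ℂ := by simp
  exact ((inner_elt (γ := γ) 0 g k k' 0 0).trans h).symm

theorem isShortExact (hG : G.IsWeakMarkov) (hK : K.IsWeakMarkov) :
    IsShortExact G (cascade G K γ) K (baseIncl G K γ) (baseProj G K γ) where
  morphism_left := isMorphism_baseIncl hG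
  isometric := isometry_baseIncl
  morphism_right := isMorphism_baseProj hK
  coisometric := by
    ext k
    exact congrArg (fun x => ((baseProj G K γ x : K.base) : 𝒦)) (adjoint_baseProj k)
  exact := by
    apply le_antisymm
    · rintro _ ⟨g, rfl⟩
      rfl
    · intro x hx
      obtain ⟨g, k, rfl⟩ := exists_base_eq_elt x
      have hk : k = 0 := hx
      subst hk
      exact ⟨g, rfl⟩

/-! ### The position of `𝒢` and `𝒦` in the cascade -/

section Embedding

variable {j : 𝒢 →ₗᵢ[ℂ] CascadeSpace G K γ}

/-- The component in `𝔤` of an element of the embedded `𝒢` is the projection onto `𝔤`. -/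
theorem exists_map_eq_elt (hj : ∀ g : G.base, j g = elt γ g 0 0) (x : 𝒢) :
    ∃ k d, j x = elt γ (G.base.orthogonalProjectionOnto x) k d := by
  obtain ⟨g, k, d, h⟩ := exists_eq_elt (j x)
  refine ⟨k, d, ?_⟩
  have hg : g = G.base.orthogonalProjectionOnto x := by
    refine ext_inner_right ℂ fun y => ?_
    have h1 : ⟪j x, j y⟫_ℂ = ⟪elt γ g k d, elt γ y 0 0⟫_ℂ := congrArg₂ (inner ℂ) h (hj y)
    have h2 := (j.inner_map_map x y).symm.trans (h1.trans (inner_elt g y k 0 d 0))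
    rw [Submodule.inner_orthogonalProjectionOnto_eq_of_mem_right, h2]
    simp
  rw [h, hg]

/-- On `E^𝔤` the embedding of `𝒢` is `ξ ↦ (0, γ^* ξ, (D_{γ^*} ξ)_0)`. -/
theorem map_wandering (hj : ∀ g : G.base, j g = elt γ g 0 0)
    (hV : ∀ i x, j (G.V i x) = V G K γ i (j x)) (ξ : G.wandering) :
    j ξ = elt γ 0 (ContinuousLinearMap.adjoint γ ξ)
      (defectZero G K γ (toDefectSpace (ContinuousLinearMap.adjoint γ) ξ)) := by
  set L : G.wandering →L[ℂ] CascadeSpace G K γ :=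
    (inclK G K γ).toContinuousLinearMap ∘L K.wanderingStar.subtypeL ∘L
        ContinuousLinearMap.adjoint γ
      + inclDefect γ ∘L defectZero G K γ ∘L toDefectSpace (ContinuousLinearMap.adjoint γ) with hL
  set M : G.wandering →L[ℂ] CascadeSpace G K γ := j.toContinuousLinearMap ∘L G.wandering.subtypeL
  have key : ∀ (k : 𝒦) (d : CascadeDefect G K γ), elt γ 0 k 0 + elt γ 0 0 d = elt γ 0 k d :=
    fun k d => (elt_add 0 0 k 0 0 d).trans (by congr 1 <;> simp)
  have htop : LinearMap.eqLocus M.toLinearMap L.toLinearMap = ⊤ := by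
    refine ProcessData.wandering_eq_top (isClosed_eq M.continuous L.continuous) fun i x hx => ?_
    change j (wanderingPart G i ⟨x, hx⟩ : 𝒢) = elt γ 0 _ 0 + elt γ 0 0 _
    have h1 := ProcessData.starProjection_base_add_starProjection_wandering
      (G.map_mem_closure i hx)
    have h2 := (V_elt_fst (γ := γ) i ⟨x, hx⟩).trans (elt_eq_add _ _ _)
    have h3 : j (G.V i x) = V G K γ i (elt γ ⟨x, hx⟩ 0 0) :=
      (hV i x).trans (congrArg _ (hj ⟨x, hx⟩))
    have h4 : j (G.V i x) = elt γ (G.base.orthogonalProjectionOnto (G.V i x)) 0 0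
        + j (wanderingPart G i ⟨x, hx⟩ : 𝒢) :=
      (congrArg j h1.symm).trans ((j.map_add _ _).trans
        (congrArg (· + _) (hj (G.base.orthogonalProjectionOnto (G.V i x)))))
    exact add_left_cancel (h4.symm.trans (h3.trans h2))
  have h1 : ξ ∈ (⊤ : Submodule ℂ G.wandering) := trivial
  rw [← htop] at h1
  exact (show j ξ = elt γ 0 _ 0 + elt γ 0 0 _ from h1).trans (key _ _)

theorem inner_inclK_map_wandering (hj : ∀ g : G.base, j g = elt γ g 0 0)
    (hV : ∀ i x, j (G.V i x) = V G K γ i (j x)) (k : 𝒦) (ξ : G.wandering) :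
    ⟪inclK G K γ k, j ξ⟫_ℂ = ⟪k, (ContinuousLinearMap.adjoint γ ξ : 𝒦)⟫_ℂ :=
  (congrArg (inner ℂ (inclK G K γ k)) (map_wandering hj hV ξ)).trans
    ((inner_elt (γ := γ) 0 0 k _ 0 _).trans (by simp))

theorem inner_V_elt_inclK (hK : K.IsWeakMarkov) (i : ι) (g : G.base) (k : 𝒦)
    (d : CascadeDefect G K γ) (η : K.wanderingStar) :
    ⟪V G K γ i (elt γ g k d), inclK G K γ η⟫_ℂ = ⟪wanderingPart G i g, γ η⟫_ℂ := by
  have h1 : ⟪K.V i k, (η : 𝒦)⟫_ℂ = 0 := hK.inner_map_wanderingStar i k η.2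
  have h2 : ⟪(ContinuousLinearMap.adjoint γ (wanderingPart G i g) : 𝒦), (η : 𝒦)⟫_ℂ
      = ⟪wanderingPart G i g, γ η⟫_ℂ :=
    ContinuousLinearMap.adjoint_inner_left γ η (wanderingPart G i g)
  have h3 : ⟪(ContinuousLinearMap.adjoint γ (wanderingPart G i g) : 𝒦) + K.V i k, (η : 𝒦)⟫_ℂ
      = ⟪wanderingPart G i g, γ η⟫_ℂ := by
    rw [inner_add_left, h1, h2, add_zero]
  have key : ∀ {r s t u : ℂ}, r = 0 → s = u → t = 0 → r + (s + t) = u := by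
    rintro _ s _ _ rfl rfl rfl
    rw [add_zero, zero_add]
  exact key (inner_zero_right _) h3 (inner_zero_right _)

theorem inner_map_V_inclK (hG : G.IsWeakMarkov) (hK : K.IsWeakMarkov)
    (hj : ∀ g : G.base, j g = elt γ g 0 0)
    (hV : ∀ i x, j (G.V i x) = V G K γ i (j x)) (i : ι) (y : 𝒢) (η : K.wanderingStar) :
    ⟪j (G.V i y), inclK G K γ η⟫_ℂ = ⟪G.V i y, (γ η : 𝒢)⟫_ℂ := by
  obtain ⟨k, d, h⟩ := exists_map_eq_elt hj y
  have h1 : j (G.V i y) = V G K γ i (elt γ (G.base.orthogonalProjectionOnto y) k d) :=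
    (hV i y).trans (congrArg _ h)
  -- `γ η` is orthogonal to `V_i 𝔤ᗮ`, so that only the component of `y` in `𝔤` contributes.
  have h2 : ⟪G.V i y, (γ η : 𝒢)⟫_ℂ
      = ⟪wanderingPart G i (G.base.orthogonalProjectionOnto y), γ η⟫_ℂ :=
    (hG.inner_map_eq_inner_map_starProjection i y (γ η).2.1).trans
      (Submodule.inner_orthogonalProjectionOnto_eq_of_mem_right (γ η) _).symm
  exact (congrArg (inner ℂ · (inclK G K γ η)) h1).trans
    ((inner_V_elt_inclK hK i _ k d η).trans h2.symm)

/-- The functional given by `η` in `E_*^𝔨` on the embedded `𝒢` is the one given by `γ η`. -/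
theorem inner_map_inclK (hG : G.IsWeakMarkov) (hK : K.IsWeakMarkov)
    (hj : ∀ g : G.base, j g = elt γ g 0 0)
    (hV : ∀ i x, j (G.V i x) = V G K γ i (j x)) (x : 𝒢) (η : K.wanderingStar) :
    ⟪j x, inclK G K γ η⟫_ℂ = ⟪x, (γ η : 𝒢)⟫_ℂ := by
  set v : 𝒢 := ContinuousLinearMap.adjoint j.toContinuousLinearMap (inclK G K γ η)
  have hv : ∀ y, ⟪j y, inclK G K γ η⟫_ℂ = ⟪y, v⟫_ℂ := fun y =>
    (ContinuousLinearMap.adjoint_inner_right j.toContinuousLinearMap y _).symm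
  have h0 : ∀ g ∈ G.base, ⟪j g, inclK G K γ η⟫_ℂ = ⟪g, (γ η : 𝒢)⟫_ℂ := fun g hg => by
    rw [Submodule.inner_right_of_mem_orthogonal hg (γ η).2.2]
    exact (congrArg (inner ℂ · (inclK G K γ η)) (hj ⟨g, hg⟩)).trans
      ((inner_elt (γ := γ) ⟨g, hg⟩ 0 0 η 0 0).trans (by simp))
  have h1 := fun i y => inner_map_V_inclK hG hK hj hV i y η
  -- The two functionals agree on `𝔤` and on the ranges of the `V_i`, hence everywhere.
  have htop : (ℂ ∙ (v - (γ η : 𝒢)))ᗮ = ⊤ := by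
    refine hG.eq_top (Submodule.isClosed_orthogonal _) (fun g hg => ?_) fun i y _ => ?_
    · rw [Submodule.mem_orthogonal_singleton_iff_inner_left, inner_sub_right, ← hv, h0 g hg,
        sub_self]
    · rw [Submodule.mem_orthogonal_singleton_iff_inner_left, inner_sub_right, ← hv, h1 i y,
        sub_self]
  have hx : x ∈ (⊤ : Submodule ℂ 𝒢) := trivial
  rw [← htop, Submodule.mem_orthogonal_singleton_iff_inner_left, inner_sub_right, ← hv] at hx
  exact sub_eq_zero.1 hx

theorem isSubprocessOf (hG : G.IsWeakMarkov)
    (hj : ∀ g : G.base, j g = elt γ g 0 0)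
    (hV : ∀ i x, j (G.V i x) = V G K γ i (j x)) : IsSubprocessOf G (cascade G K γ) j where
  base_le := by
    rintro _ ⟨g, hg, rfl⟩
    exact Set.mem_of_eq_of_mem (hj ⟨g, hg⟩) (elt_mem_base.2 ⟨zero_mem _, rfl⟩)
  coinvariant := by
    rintro i _ ⟨g, hg, rfl⟩
    refine ⟨ContinuousLinearMap.adjoint (G.V i) g, hG.coinvariant i g hg, ?_⟩
    exact (hj ⟨_, hG.coinvariant i g hg⟩).trans ((adjoint_V_elt_fst hG i ⟨g, hg⟩).symm.trans
      (congrArg _ (hj ⟨g, hg⟩).symm))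
  range_eq := hG.range_eq_orbitSpan j hV
  intertwine := hV

theorem map_inclK_base (hj : ∀ g : G.base, j g = elt γ g 0 0) :
    K.base.map (inclK G K γ).toLinearMap
      = (cascade G K γ).base ⊓ (G.base.map j.toLinearMap)ᗮ := by
  apply le_antisymm
  · rintro _ ⟨k, hk, rfl⟩
    refine ⟨elt_mem_base.2 ⟨hk, rfl⟩, ?_⟩
    rintro _ ⟨g, hg, rfl⟩
    exact (congrArg (inner ℂ · (inclK G K γ k)) (hj ⟨g, hg⟩)).trans
      ((inner_elt (γ := γ) ⟨g, hg⟩ 0 0 k 0 0).trans (by simp))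
  · rintro x ⟨hx, hx'⟩
    obtain ⟨g, k, d, rfl⟩ := exists_eq_elt x
    obtain ⟨hk, rfl⟩ := elt_mem_base.1 hx
    have h1 := hx' _ ⟨g, g.2, rfl⟩
    have h2 := (congrArg (inner ℂ · (elt γ g k 0)) (hj g)).symm.trans h1
    have h3 := (inner_elt (γ := γ) g g 0 k 0 0).symm.trans h2
    have h4 : g = 0 := by simpa using h3
    subst h4
    exact ⟨k, hk, rfl⟩

theorem isQuotientOf (hK : K.IsWeakMarkov) (hj : ∀ g : G.base, j g = elt γ g 0 0) :
    IsQuotientOf (cascade G K γ) (G.base.map j.toLinearMap) K (inclK G K γ) where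
  base_eq := map_inclK_base hj
  range_eq := by
    rw [← map_inclK_base hj]
    exact hK.range_eq_orbitSpan (inclK G K γ) fun i k => (V_elt_snd i k).symm
  intertwine i k := (V_elt_snd i k).symm

end Embedding

end Cascade

end Cascade

/-! ### Extensions are classified by their coupling -/

section Classification

variable {ι 𝒢 ℋ ℋ' 𝒦 : Type*}
  [NormedAddCommGroup 𝒢] [InnerProductSpace ℂ 𝒢] [CompleteSpace 𝒢]
  [NormedAddCommGroup ℋ] [InnerProductSpace ℂ ℋ] [CompleteSpace ℋ]
  [NormedAddCommGroup ℋ'] [InnerProductSpace ℂ ℋ'] [CompleteSpace ℋ']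
  [NormedAddCommGroup 𝒦] [InnerProductSpace ℂ 𝒦] [CompleteSpace 𝒦]
  {G : ProcessData ι 𝒢} {H : ProcessData ι ℋ} {H' : ProcessData ι ℋ'} {K : ProcessData ι 𝒦}
  {a : G.base →L[ℂ] H.base} {b : H.base →L[ℂ] K.base}
  {a' : G.base →L[ℂ] H'.base} {b' : H'.base →L[ℂ] K.base}

namespace IsShortExact

theorem inner_map_V_map (h : IsShortExact G H K a b) (i : ι) (g g' : G.base) :
    ⟪(a g : ℋ), H.V i (a g')⟫_ℂ = ⟪(g : 𝒢), G.V i g'⟫_ℂ := by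
  obtain ⟨y, hy, hy'⟩ := h.morphism_left.inner_map i g
  rw [hy, hy']
  exact inner_map_map_of_isometry h.isometric y g'

theorem inner_adjoint_V_adjoint (h : IsShortExact G H K a b) (i : ι) (k k' : K.base) :
    ⟪((ContinuousLinearMap.adjoint b k : H.base) : ℋ),
      H.V i (ContinuousLinearMap.adjoint b k' : H.base)⟫_ℂ = ⟪(k : 𝒦), K.V i k'⟫_ℂ := by
  obtain ⟨y, hy, hy'⟩ := h.morphism_right.inner_map i (ContinuousLinearMap.adjoint b k)
  rw [h.map_adjoint] at hy'
  rw [hy, hy']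
  exact ContinuousLinearMap.adjoint_inner_right b y k'

/-- The middle terms of two short exact sequences with the same ends have unitarily equivalent
bases, by the decomposition `𝔥 = a(𝔤) ⊕ b^*(𝔨)`. -/
theorem exists_linearIsometryEquiv (h : IsShortExact G H K a b)
    (h' : IsShortExact G H' K a' b') :
    ∃ j : H.base ≃ₗᵢ[ℂ] H'.base, (∀ g, j (a g) = a' g) ∧
      ∀ k, j (ContinuousLinearMap.adjoint b k) = ContinuousLinearMap.adjoint b' k := by
  have haa : ∀ g, ContinuousLinearMap.adjoint a (a g) = g := fun g =>
    ext_inner_right ℂ fun y => by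
      rw [ContinuousLinearMap.adjoint_inner_left, inner_map_map_of_isometry h.isometric]
  have hab : ∀ k, ContinuousLinearMap.adjoint a (ContinuousLinearMap.adjoint b k) = 0 := fun k =>
    ext_inner_left ℂ fun y => by
      rw [ContinuousLinearMap.adjoint_inner_right, h.inner_map_adjoint, inner_zero_right]
  set L : H.base →L[ℂ] H'.base :=
    a' ∘L ContinuousLinearMap.adjoint a + ContinuousLinearMap.adjoint b' ∘L b
  have hL : ∀ x, L x = a' (ContinuousLinearMap.adjoint a x)
    + ContinuousLinearMap.adjoint b' (b x) := fun x => rfl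
  have hLa : ∀ g, L (a g) = a' g := fun g => by
    rw [hL, haa, h.map_map, map_zero, add_zero]
  have hLb : ∀ k, L (ContinuousLinearMap.adjoint b k) = ContinuousLinearMap.adjoint b' k :=
    fun k => by rw [hL, hab, h.map_adjoint, map_zero, zero_add]
  have hnorm : ∀ x, ‖L x‖ = ‖x‖ := fun x => by
    obtain ⟨g, hx⟩ := h.exists_eq_map_add_adjoint x
    have key : ⟪L x, L x⟫_ℂ = ⟪x, x⟫_ℂ := by
      rw [hx, map_add, hLa, hLb,
        inner_add_add_of_inner_eq_zero (h.inner_map_adjoint g _)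
          (inner_eq_zero_symm.1 (h.inner_map_adjoint g _)),
        inner_add_add_of_inner_eq_zero (h'.inner_map_adjoint g _)
          (inner_eq_zero_symm.1 (h'.inner_map_adjoint g _)),
        inner_map_map_of_isometry h.isometric, inner_map_map_of_isometry h'.isometric,
        h.inner_adjoint_adjoint, h'.inner_adjoint_adjoint]
    rw [@norm_eq_sqrt_re_inner ℂ, @norm_eq_sqrt_re_inner ℂ, key]
  refine ⟨LinearIsometryEquiv.ofSurjective ⟨L.toLinearMap, hnorm⟩ fun y => ?_, hLa, hLb⟩
  obtain ⟨g, hy⟩ := h'.exists_eq_map_add_adjoint y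
  refine ⟨a g + ContinuousLinearMap.adjoint b (b' y), ?_⟩
  change L (a g + ContinuousLinearMap.adjoint b (b' y)) = y
  rw [map_add, hLa, hLb, ← hy]

/-- With respect to `𝔥 = a(𝔤) ⊕ b^*(𝔨)`, the compression of `V_i` is a triangular operator matrix
whose diagonal is determined by the ends of the sequence.  So two extensions are equivalent if and
only if their off-diagonal entries agree. -/
theorem extensionsEquivalent_iff (h : IsShortExact G H K a b) (h' : IsShortExact G H' K a' b')
    (hH : IsCoinvariant H.V H.base) (hH' : IsCoinvariant H'.V H'.base) :
    ExtensionsEquivalent a b a' b' ↔ ∀ (i : ι) (g : G.base) (k : K.base),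
      ⟪((ContinuousLinearMap.adjoint b k : H.base) : ℋ), H.V i (a g)⟫_ℂ
        = ⟪((ContinuousLinearMap.adjoint b' k : H'.base) : ℋ'), H'.V i (a' g)⟫_ℂ := by
  constructor
  · rintro ⟨j, hj, -, hja, hjb⟩ i g k
    have hjk : j (ContinuousLinearMap.adjoint b k) = ContinuousLinearMap.adjoint b' k := by
      refine ext_inner_right ℂ fun y => ?_
      obtain ⟨x, rfl⟩ := j.surjective y
      rw [j.inner_map_map, ContinuousLinearMap.adjoint_inner_left,
        ContinuousLinearMap.adjoint_inner_left, hjb]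
    obtain ⟨y, hy, hy'⟩ := hj.inner_map i (ContinuousLinearMap.adjoint b k)
    have h1 : ⟪(j (ContinuousLinearMap.adjoint b k) : ℋ'), H'.V i (a' g)⟫_ℂ
        = ⟪(j y : ℋ'), (a' g : ℋ')⟫_ℂ := hy' _
    rw [← hjk, hy, h1, ← hja]
    exact (j.inner_map_map y (a g)).symm
  · intro hc
    obtain ⟨j, hja, hjb⟩ := h.exists_linearIsometryEquiv h'
    have hV : ∀ (i : ι) (x z : H.base), ⟪(j x : ℋ'), H'.V i (j z)⟫_ℂ = ⟪(x : ℋ), H.V i z⟫_ℂ := by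
      intro i x z
      obtain ⟨g, hx⟩ := h.exists_eq_map_add_adjoint x
      obtain ⟨g', hz⟩ := h.exists_eq_map_add_adjoint z
      rw [hx, hz, map_add, map_add, hja, hja, hjb, hjb]
      simp only [Submodule.coe_add, map_add, inner_add_left, inner_add_right]
      rw [h.inner_map_V_map, h'.inner_map_V_map, h.inner_map_V_adjoint, h'.inner_map_V_adjoint,
        h.inner_adjoint_V_adjoint, h'.inner_adjoint_V_adjoint, hc]
    have hmor : IsMorphism H H' (j : H.base →L[ℂ] H'.base) := by
      refine ⟨ContinuousLinearMap.opNorm_le_bound _ zero_le_one fun x => ?_, fun i x => ?_⟩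
      · rw [one_mul]
        exact (j.norm_map x).le
      · refine ⟨⟨_, hH i x x.2⟩, rfl, ?_⟩
        set y : H.base := ⟨_, hH i x x.2⟩
        have hy : (⟨_, hH' i (j x) (j x).2⟩ : H'.base) = j y := by
          refine ext_inner_right ℂ fun z' => ?_
          obtain ⟨z, rfl⟩ := j.surjective z'
          rw [j.inner_map_map]
          change ⟪ContinuousLinearMap.adjoint (H'.V i) (j x : ℋ'), (j z : ℋ')⟫_ℂ
            = ⟪ContinuousLinearMap.adjoint (H.V i) (x : ℋ), (z : ℋ)⟫_ℂ
          rw [ContinuousLinearMap.adjoint_inner_left, ContinuousLinearMap.adjoint_inner_left, hV]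
        exact congrArg Subtype.val hy
    refine ⟨j, hmor, hmor.symm, hja, fun x => ?_⟩
    obtain ⟨g, hx⟩ := h.exists_eq_map_add_adjoint x
    rw [hx, map_add, hja, hjb, map_add, map_add, h.map_map, h'.map_map, h'.map_adjoint,
      h.map_adjoint]

/-- `V_i b^*(𝔨)` is orthogonal to the span of `a(𝔤)` and all `V_l a(𝔤)`. -/
theorem inner_V_adjoint_map_eq_zero (h : IsShortExact G H K a b) (hH : IsRowIsometry H.V)
    {j : 𝒢 →ₗᵢ[ℂ] ℋ} (hj : ∀ g : G.base, j g = a g) (hV : ∀ i x, j (G.V i x) = H.V i (j x))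
    (i : ι) (k : K.base) {y : 𝒢} (hy : y ∈ (G.base ⊔ G.imageSpan).topologicalClosure) :
    ⟪H.V i (ContinuousLinearMap.adjoint b k : H.base), j y⟫_ℂ = 0 := by
  have hv : ∀ y, ⟪ContinuousLinearMap.adjoint j.toContinuousLinearMap
      (H.V i (ContinuousLinearMap.adjoint b k : H.base)), y⟫_ℂ
        = ⟪H.V i (ContinuousLinearMap.adjoint b k : H.base), j y⟫_ℂ := fun y =>
    ContinuousLinearMap.adjoint_inner_left j.toContinuousLinearMap y _
  rw [← hv]
  refine ProcessData.inner_eq_zero_of_mem_closure (fun x hx => ?_) (fun l x hx => ?_) hy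
  · rw [hv, hj ⟨x, hx⟩]
    exact inner_eq_zero_symm.1 (h.inner_map_V_adjoint i ⟨x, hx⟩ k)
  · rw [hv, hV, hj ⟨x, hx⟩]
    by_cases hil : i = l
    · subst hil
      rw [hH.inner_map_map]
      exact inner_eq_zero_symm.1 (h.inner_map_adjoint ⟨x, hx⟩ k)
    · exact hH.2 i l hil _ _

/-- The off-diagonal entries of every extension are of the form `γ^* P_{E^𝔤} V_i^G`: with
`𝒢` and `𝒦` embedded into `ℋ`, the contraction `γ` is the compression of the identity to a map from
`E_*^𝔨` to `E^𝔤`. -/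
theorem exists_coupling (h : IsShortExact G H K a b) (hG : G.IsWeakMarkov) (hK : K.IsWeakMarkov)
    (hH : IsRowIsometry H.V) : ∃ γ : K.wanderingStar →L[ℂ] G.wandering, ‖γ‖ ≤ 1 ∧
      ∀ (i : ι) (g : G.base) (k : K.base),
        ⟪(k : 𝒦), (ContinuousLinearMap.adjoint γ (Cascade.wanderingPart G i g) : 𝒦)⟫_ℂ
          = ⟪((ContinuousLinearMap.adjoint b k : H.base) : ℋ), H.V i (a g)⟫_ℂ := by
  obtain ⟨jG, hjG, hGV⟩ := h.morphism_left.exists_intertwining hG hH h.isometric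
  obtain ⟨jK, hjK, hKV⟩ := h.exists_intertwining_adjoint hK hH
  -- `T` is the compression `jK^* jG : 𝒢 → 𝒦` of the identity of `ℋ`.
  obtain ⟨T, hT⟩ : ∃ T : 𝒢 →L[ℂ] 𝒦, ∀ (x : 𝒦) (y : 𝒢), ⟪x, T y⟫_ℂ = ⟪jK x, jG y⟫_ℂ :=
    ⟨ContinuousLinearMap.adjoint jK.toContinuousLinearMap ∘L jG.toContinuousLinearMap,
      fun x y => ContinuousLinearMap.adjoint_inner_right jK.toContinuousLinearMap x (jG y)⟩
  have hTn : ∀ y, ‖T y‖ ≤ ‖y‖ := fun y => by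
    have h1 := norm_inner_le_norm (𝕜 := ℂ) (jK (T y)) (jG y)
    rw [← hT, jK.norm_map, jG.norm_map, inner_self_eq_norm_sq_to_K] at h1
    have h2 : ‖T y‖ * ‖T y‖ ≤ ‖T y‖ * ‖y‖ := by simpa [sq] using h1
    rcases (norm_nonneg (T y)).eq_or_lt with h0 | h0
    · rw [← h0]; exact norm_nonneg y
    · exact le_of_mul_le_mul_left h2 h0
  -- The adjoint of the contraction is the compression of `T` to a map from `E^𝔤` to `E_*^𝔨`.
  obtain ⟨δ, hδ⟩ : ∃ δ : G.wandering →L[ℂ] K.wanderingStar,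
      ∀ ξ : G.wandering, δ ξ = K.wanderingStar.orthogonalProjectionOnto (T ξ) :=
    ⟨K.wanderingStar.orthogonalProjectionOnto ∘L T ∘L G.wandering.subtypeL, fun ξ => rfl⟩
  have hδn : ‖δ‖ ≤ 1 := ContinuousLinearMap.opNorm_le_bound _ zero_le_one fun ξ => by
    rw [one_mul, hδ]
    exact (Submodule.norm_orthogonalProjectionOnto_apply_le K.wanderingStar (T ξ)).trans (hTn ξ)
  have horth : ∀ ξ : G.wandering, T ξ ∈ K.imageSpanᗮ := fun ξ => by
    have hle : K.imageSpan ≤ (ℂ ∙ T ξ)ᗮ := iSup_le fun i => by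
      rintro _ ⟨k, hk, rfl⟩
      have h1 : jK (K.V i k) = H.V i (ContinuousLinearMap.adjoint b ⟨k, hk⟩ : H.base) :=
        (hKV i k).trans (congrArg _ (hjK ⟨k, hk⟩))
      have h2 : ⟪K.V i k, T ξ⟫_ℂ = 0 := by
        rw [hT, h1]
        exact h.inner_V_adjoint_map_eq_zero hH hjG hGV i ⟨k, hk⟩ ξ.2.1
      exact Submodule.mem_orthogonal_singleton_iff_inner_left.2 h2
    exact fun u hu => Submodule.mem_orthogonal_singleton_iff_inner_left.1 (hle hu)
  refine ⟨ContinuousLinearMap.adjoint δ, norm_adjoint_le hδn, fun i g k => ?_⟩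
  rw [ContinuousLinearMap.adjoint_adjoint]
  set ξ := Cascade.wanderingPart G i g
  have h1 : ⟪T ξ, (k : 𝒦)⟫_ℂ = ⟪T ξ, K.wanderingStar.starProjection k⟫_ℂ :=
    ProcessData.inner_eq_inner_starProjection_wanderingStar (horth ξ) (K.mem_closure_of_base k.2)
  have h2 : ⟪(k : 𝒦), (δ ξ : 𝒦)⟫_ℂ = ⟪(k : 𝒦), T ξ⟫_ℂ := by
    rw [hδ, ← inner_conj_symm (k : 𝒦) (T ξ), h1, inner_conj_symm]
    exact (Submodule.inner_starProjection_left_eq_right K.wanderingStar (k : 𝒦) (T ξ)).symm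
  have h3 := ProcessData.starProjection_base_add_starProjection_wandering
    (G.map_mem_closure i g.2)
  have h4 : H.V i (a g) = a (G.base.orthogonalProjectionOnto (G.V i g)) + jG ξ := by
    rw [← hjG, ← hGV, ← hjG, ← map_add]
    exact congrArg jG h3.symm
  rw [h2, hT, hjK, h4, inner_add_right]
  have h5 : ⟪((ContinuousLinearMap.adjoint b k : H.base) : ℋ),
      (a (G.base.orthogonalProjectionOnto (G.V i g)) : ℋ)⟫_ℂ = 0 :=
    inner_eq_zero_symm.1 (h.inner_map_adjoint _ k)
  rw [h5, zero_add]

end IsShortExact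

namespace Cascade

variable {γ γ₁ γ₂ : K.wanderingStar →L[ℂ] G.wandering}

/-- The off-diagonal entries of the `γ`-cascade are `γ^* P_{E^𝔤} V_i^G`. -/
theorem inner_adjoint_baseProj_V_baseIncl (i : ι) (g : G.base) (k : K.base) :
    ⟪((ContinuousLinearMap.adjoint (baseProj G K γ) k : (cascade G K γ).base) :
      CascadeSpace G K γ), (cascade G K γ).V i (baseIncl G K γ g)⟫_ℂ
        = ⟪(k : 𝒦), (ContinuousLinearMap.adjoint γ (wanderingPart G i g) : 𝒦)⟫_ℂ := by
  have h1 : ((ContinuousLinearMap.adjoint (baseProj G K γ) k : (cascade G K γ).base) :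
      CascadeSpace G K γ) = elt γ 0 k 0 := congrArg Subtype.val (adjoint_baseProj k)
  have h2 : (cascade G K γ).V i (baseIncl G K γ g) = _ := V_elt_fst (γ := γ) i g
  exact (congrArg₂ (inner ℂ) h1 h2).trans ((inner_elt (γ := γ) 0 _ k _ 0 _).trans (by simp))

/-- `γ^* P_{E^𝔤} V_i^G`, tested against `𝔨`, determines `γ`: the vectors `P_{E^𝔤} V_i^G g` are
total in `E^𝔤`, and no nonzero vector of `E_*^𝔨` is orthogonal to `𝔨`. -/
theorem eq_of_inner_adjoint_eq (h : ∀ (i : ι) (g : G.base) (k : K.base),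
    ⟪(k : 𝒦), (ContinuousLinearMap.adjoint γ₁ (wanderingPart G i g) : 𝒦)⟫_ℂ
      = ⟪(k : 𝒦), (ContinuousLinearMap.adjoint γ₂ (wanderingPart G i g) : 𝒦)⟫_ℂ) : γ₁ = γ₂ := by
  have htop : LinearMap.eqLocus (ContinuousLinearMap.adjoint γ₁).toLinearMap
      (ContinuousLinearMap.adjoint γ₂).toLinearMap = ⊤ := by
    refine ProcessData.wandering_eq_top (isClosed_eq (ContinuousLinearMap.adjoint γ₁).continuous
      (ContinuousLinearMap.adjoint γ₂).continuous) fun i x hx => ?_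
    set ξ := wanderingPart G i ⟨x, hx⟩
    change ContinuousLinearMap.adjoint γ₁ ξ = ContinuousLinearMap.adjoint γ₂ ξ
    set u := ContinuousLinearMap.adjoint γ₁ ξ - ContinuousLinearMap.adjoint γ₂ ξ with hu
    have h1 : ⟪(u : 𝒦), (u : 𝒦)⟫_ℂ = 0 := by
      refine ProcessData.inner_eq_zero_of_mem_closure (fun k hk => ?_) (fun l k hk => ?_) u.2.1
      · rw [inner_eq_zero_symm, hu, Submodule.coe_sub, inner_sub_right, sub_eq_zero]
        exact h i ⟨x, hx⟩ ⟨k, hk⟩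
      · exact Submodule.inner_left_of_mem_orthogonal (K.map_mem_imageSpan l hk) u.2.2
    exact sub_eq_zero.1 (Subtype.ext (inner_self_eq_zero.1 h1))
  have h1 : ContinuousLinearMap.adjoint γ₁ = ContinuousLinearMap.adjoint γ₂ := by
    ext1 ξ
    have hξ : ξ ∈ (⊤ : Submodule ℂ G.wandering) := trivial
    rw [← htop] at hξ
    exact hξ
  exact ContinuousLinearMap.adjoint.injective h1

end Cascade

end Classification

theorem mainTheorem1 {ι : Type*} {𝒢 : Type*} {𝒦 : Type*}
    [NormedAddCommGroup 𝒢] [InnerProductSpace ℂ 𝒢] [CompleteSpace 𝒢]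
    [NormedAddCommGroup 𝒦] [InnerProductSpace ℂ 𝒦] [CompleteSpace 𝒦]
    (G : ProcessData ι 𝒢) (K : ProcessData ι 𝒦) (hG : G.IsWeakMarkov) (hK : K.IsWeakMarkov) :
    -- every cascade is a process and an extension of `K` by `G`, with the stated geometry
    (∀ γ : K.wanderingStar →L[ℂ] G.wandering, ‖γ‖ ≤ 1 →
      (cascade G K γ).IsWeakMarkov ∧
      (Countable ι → TopologicalSpace.SeparableSpace 𝒢 → TopologicalSpace.SeparableSpace 𝒦 →
        TopologicalSpace.SeparableSpace (CascadeSpace G K γ)) ∧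
      (∃ jG : 𝒢 →ₗᵢ[ℂ] CascadeSpace G K γ,
        (∀ g : G.base, jG (g : 𝒢) = (Cascade.baseIncl G K γ g : CascadeSpace G K γ)) ∧
        IsSubprocessOf G (cascade G K γ) jG ∧
        IsQuotientOf (cascade G K γ) (G.base.map jG.toLinearMap) K (Cascade.inclK G K γ) ∧
        (∀ η : K.wanderingStar,
          imageProj jG G.wandering (Cascade.inclK G K γ η) = jG (γ η) ∧
          imageProj jG ⊤ (Cascade.inclK G K γ η) = jG (γ η)) ∧
        (∀ ξ : G.wandering,
          imageProj (Cascade.inclK G K γ) K.wanderingStar (jG ξ)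
            = Cascade.inclK G K γ (ContinuousLinearMap.adjoint γ ξ) ∧
          imageProj (Cascade.inclK G K γ) ⊤ (jG ξ)
            = Cascade.inclK G K γ (ContinuousLinearMap.adjoint γ ξ))) ∧
      IsShortExact G (cascade G K γ) K (Cascade.baseIncl G K γ) (Cascade.baseProj G K γ)) ∧
    -- every extension of `K` by `G` is equivalent to exactly one cascade
    (∀ (ℋ : Type*) [NormedAddCommGroup ℋ] [InnerProductSpace ℂ ℋ] [CompleteSpace ℋ]
      (H : ProcessData ι ℋ), H.IsWeakMarkov →
      ∀ (a : G.base →L[ℂ] H.base) (b : H.base →L[ℂ] K.base), IsShortExact G H K a b →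
        ∃! γ : K.wanderingStar →L[ℂ] G.wandering, ‖γ‖ ≤ 1 ∧
          ExtensionsEquivalent (Cascade.baseIncl G K γ) (Cascade.baseProj G K γ) a b) ∧
    -- two cascades are equivalent extensions if and only if the contractions are equal
    (∀ γ₁ γ₂ : K.wanderingStar →L[ℂ] G.wandering, ‖γ₁‖ ≤ 1 → ‖γ₂‖ ≤ 1 →
      (ExtensionsEquivalent (Cascade.baseIncl G K γ₁) (Cascade.baseProj G K γ₁)
        (Cascade.baseIncl G K γ₂) (Cascade.baseProj G K γ₂) ↔ γ₁ = γ₂)) := by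
  refine ⟨fun γ hγ => ?_, ?_, ?_⟩
  · have hH := isWeakMarkov_cascade hG hK hγ
    obtain ⟨jG, hj, hV⟩ := (Cascade.isMorphism_baseIncl (K := K) (γ := γ) hG).exists_intertwining
      hG hH.rowIsometry Cascade.isometry_baseIncl
    refine ⟨hH, fun _ _ _ => separableSpace_cascade hH.minimal, ⟨jG, hj,
      Cascade.isSubprocessOf hG hj hV, Cascade.isQuotientOf hK hj, fun η => ⟨?_, ?_⟩,
      fun ξ => ⟨?_, ?_⟩⟩, Cascade.isShortExact hG hK⟩
    · exact imageProj_eq (γ η).2 fun x => Cascade.inner_map_inclK hG hK hj hV x η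
    · exact imageProj_eq trivial fun x => Cascade.inner_map_inclK hG hK hj hV x η
    · exact imageProj_eq (ContinuousLinearMap.adjoint γ ξ).2
        fun x => Cascade.inner_inclK_map_wandering hj hV x ξ
    · exact imageProj_eq trivial fun x => Cascade.inner_inclK_map_wandering hj hV x ξ
  · intro ℋ _ _ _ H hH a b h
    have hiff := fun γ : K.wanderingStar →L[ℂ] G.wandering =>
      (Cascade.isShortExact (γ := γ) hG hK).extensionsEquivalent_iff h
        (Cascade.isCoinvariant hK) hH.coinvariant
    obtain ⟨γ, hγ, hc⟩ := h.exists_coupling hG hK hH.rowIsometry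
    refine ⟨γ, ⟨hγ, (hiff γ).2 fun i g k =>
      (Cascade.inner_adjoint_baseProj_V_baseIncl i g k).trans (hc i g k)⟩, ?_⟩
    rintro γ' ⟨-, he⟩
    exact Cascade.eq_of_inner_adjoint_eq fun i g k =>
      ((Cascade.inner_adjoint_baseProj_V_baseIncl i g k).symm.trans
        ((hiff γ').1 he i g k)).trans (hc i g k).symm
  · intro γ₁ γ₂ _ _
    have hiff := (Cascade.isShortExact (γ := γ₁) hG hK).extensionsEquivalent_iff
      (Cascade.isShortExact (γ := γ₂) hG hK) (Cascade.isCoinvariant hK) (Cascade.isCoinvariant hK)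
    constructor
    · intro he
      exact Cascade.eq_of_inner_adjoint_eq fun i g k =>
        ((Cascade.inner_adjoint_baseProj_V_baseIncl i g k).symm.trans (hiff.1 he i g k)).trans
          (Cascade.inner_adjoint_baseProj_V_baseIncl i g k)
    · rintro rfl
      exact hiff.2 fun i g k => rfl
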